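/- Conventions. A \emph{radial weight} is a function $\omega(z)=\omega(|z|)$ on the unit disc $\mathbb{D}$, where $\omega\in L^1([0,1))$ is nonnegative and $\widehat{\omega}(r)=\int_r^1\omega(s)\,ds>0$ for all $0\le r<1$; we put $\widehat{\omega}(z)=\widehat{\omega}(|z|)$ for $z\in\mathbb{D}$. A radial weight $\omega$ belongs to $\widehat{\mathcal{D}}$ if there is $C>0$ such that $\widehat{\omega}(r)\le C\,\widehat{\omega}\left(\frac{1+r}{2}\right)$ for all $r<1$ sufficiently close to $1$, and to $\widecheck{\mathcal{D}}$ if there are $K>1$ and $C>1$ such that $\widehat{\omega}(r)\ge C\,\widehat{\omega}\left(1-\frac{1-r}{K}\right)$ for all $r<1$ sufficiently close to $1$. Let $dA=\frac{dx\,dy}{\pi}$, let $A^2_\omega$ be the space of analytic functions $f$ in $\mathbb{D}$ with $\int_{\mathbb{D}}|f|^2\omega\,dA<\infty$, with inner product $\langle f,g\rangle=\int_{\mathbb{D}}f\overline{g}\,\omega\,dA$, and let $B^\omega_z$ be its reproducing kernel at $z\in\mathbb{D}$. The Bergman projection induced by $\omega$ is $$P_\omega(f)(z)=\int_{\mathbb{D}}f(\zeta)\,\overline{B^\omega_z(\zeta)}\,\omega(\zeta)\,dA(\zeta),\qquad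 z\in\mathbb{D}.$$ For a radial weight $\nu$, let $L^\infty_{\widehat{\nu}}$ be the space of measurable $f:\mathbb{D}\to\mathbb{C}$ with $\|f\|_{\infty,\widehat{\nu}}=\operatorname{ess\,sup}_{z\in\mathbb{D}}|f(z)|\,\widehat{\nu}(z)<\infty$, and let $H^\infty_{\widehat{\nu}}$ be the subspace of its analytic members. We say that $P_\omega:L^\infty_{\widehat{\nu}}\to H^\infty_{\widehat{\nu}}$ is bounded if for every $f\in L^\infty_{\widehat{\nu}}$ the integral defining $P_\omega(f)(z)$ converges absolutely for every $z\in\mathbb{D}$ and $P_\omega(f)\in H^\infty_{\widehat{\nu}}$, and there is a constant $C$ with $\|P_\omega(f)\|_{\infty,\widehat{\nu}}\le C\|f\|_{\infty,\widehat{\nu}}$ for all $f\in L^\infty_{\widehat{\nu}}$. Statement. Let $\omega\in\widehat{\mathcal{D}}$ be a radial weight. Then there is a radial weight $\nu$ such that $P_\omega:L^\infty_{\widehat{\nu}}\to H^\infty_{\widehat{\nu}}$ is bounded if and only if $\omega\in\widecheck{\mathcal{D}}$. In particular, if $\omega\in\widehat{\mathcal{D}}\setminus\widecheck{\mathcal{D}}$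 and $\nu$ is any radial weight, then $P_\omega$ is not bounded from $L^\infty_{\widehat{\nu}}$ to $H^\infty_{\widehat{\nu}}$. -/

import Mathlib

/-- The tail integral `ω̂(r) = ∫_r^1 ω(s) ds` of a function `ω` on `[0,1)`. -/
noncomputable def radialTail (ω : ℝ → ℝ) (r : ℝ) : ℝ := ∫ s in r..1, ω s

/-- `ω` is (the radial profile of) a radial weight `z ↦ ω(|z|)` on the unit disc: a nonnegative
function in `L¹([0,1))` whose tail integrals are all positive.
Only the values of `ω` on `[0,1)` matter. -/
structure IsRadialWeight (ω : ℝ → ℝ) : Prop where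
  nonneg : ∀ r ∈ Set.Ico (0 : ℝ) 1, 0 ≤ ω r
  integrable : MeasureTheory.IntegrableOn ω (Set.Ico (0 : ℝ) 1)
  tail_pos : ∀ r ∈ Set.Ico (0 : ℝ) 1, 0 < radialTail ω r

/-- The upper doubling condition (class `D̂`). -/
def UpperDoubling (ω : ℝ → ℝ) : Prop :=
  ∃ C : ℝ, 0 < C ∧ ∀ᶠ r in nhdsWithin (1 : ℝ) (Set.Iio 1),
    radialTail ω r ≤ C * radialTail ω ((1 + r) / 2)

/-- The lower doubling condition (class `Ď`). -/
def LowerDoubling (ω : ℝ → ℝ) : Prop :=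
  ∃ K C : ℝ, 1 < K ∧ 1 < C ∧ ∀ᶠ r in nhdsWithin (1 : ℝ) (Set.Iio 1),
    C * radialTail ω (1 - (1 - r) / K) ≤ radialTail ω r

/-- The normalized area measure `dA = dx dy / π` on the unit disc. -/
noncomputable def discArea : MeasureTheory.Measure ℂ :=
  ENNReal.ofReal (1 / Real.pi) • MeasureTheory.volume.restrict (Metric.ball (0 : ℂ) 1)

/-- Membership in the Bergman space `A²_ω`: analytic functions on the disc with
`∫ |f|² ω dA < ∞`. -/
def MemBergmanTwo (ω : ℝ → ℝ) (f : ℂ → ℂ) : Prop :=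
  DifferentiableOn ℂ f (Metric.ball 0 1) ∧
    MeasureTheory.Integrable (fun ζ : ℂ => ‖f ζ‖ ^ 2 * ω ‖ζ‖) discArea

/-- `k` is the reproducing kernel of `A²_ω` at the point `z` of the disc: `k ∈ A²_ω` and
`f(z) = ⟨f, k⟩` in `A²_ω` for all `f ∈ A²_ω`. -/
def IsReproducingKernelAt (ω : ℝ → ℝ) (z : ℂ) (k : ℂ → ℂ) : Prop :=
  MemBergmanTwo ω k ∧ ∀ f : ℂ → ℂ, MemBergmanTwo ω f →
    f z = ∫ ζ, f ζ * (starRingEnd ℂ) (k ζ) * (ω ‖ζ‖ : ℂ) ∂discArea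

/-- The Bergman reproducing kernel `B^ω_z` of `A²_ω`. For a radial weight and `z` in the disc it
exists, and its restriction to the disc is unique. -/
noncomputable def bergmanKernel (ω : ℝ → ℝ) (z : ℂ) : ℂ → ℂ :=
  Classical.epsilon (IsReproducingKernelAt ω z)

/-- The integrand of the Bergman projection of `f` at `z`. -/
noncomputable def bergmanIntegrand (ω : ℝ → ℝ) (f : ℂ → ℂ) (z ζ : ℂ) : ℂ :=
  f ζ * (starRingEnd ℂ) (bergmanKernel ω z ζ) * (ω ‖ζ‖ : ℂ)

/-- The Bergman projection `P_ω f (z) = ∫ f(ζ) conj(B^ω_z(ζ)) ω(ζ) dA(ζ)`. -/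
noncomputable def bergmanProjection (ω : ℝ → ℝ) (f : ℂ → ℂ) (z : ℂ) : ℂ :=
  ∫ ζ, bergmanIntegrand ω f z ζ ∂discArea

/-- The weighted norm `ess sup_{z ∈ 𝔻} |f(z)| v(|z|)`, as an extended nonnegative real. -/
noncomputable def growthNorm (v : ℝ → ℝ) (f : ℂ → ℂ) : ENNReal :=
  essSup (fun z : ℂ => ENNReal.ofReal (‖f z‖ * v ‖z‖)) discArea

/-- Membership in the growth space `L^∞_v`. -/
def MemGrowth (v : ℝ → ℝ) (f : ℂ → ℂ) : Prop :=
  MeasureTheory.AEStronglyMeasurable f discArea ∧ growthNorm v f < ⊤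

/-- Membership in `H^∞_v = L^∞_v ∩ H(𝔻)`. -/
def MemGrowthAnalytic (v : ℝ → ℝ) (f : ℂ → ℂ) : Prop :=
  MemGrowth v f ∧ DifferentiableOn ℂ f (Metric.ball 0 1)

/-- `P_ω` is a bounded operator from `L^∞_v` to `H^∞_v`: for every `f ∈ L^∞_v` the integral
defining `P_ω f` converges absolutely at every point of the disc, `P_ω f ∈ H^∞_v`, and
the norm of `P_ω f` is at most a fixed constant times the norm of `f`. -/
def BergmanProjectionBounded (ω v : ℝ → ℝ) : Prop :=
  ∃ C : NNReal, ∀ f : ℂ → ℂ, MemGrowth v f →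
    (∀ z ∈ Metric.ball (0 : ℂ) 1,
      MeasureTheory.Integrable (bergmanIntegrand ω f z) discArea) ∧
    MemGrowthAnalytic v (bergmanProjection ω f) ∧
    growthNorm v (bergmanProjection ω f) ≤ (C : ENNReal) * growthNorm v f

/-! The monomials are orthogonal in `A²_ω` with `‖ζⁿ‖² = 2 ω_{2n+1}`, where `ω_n = ∫₀¹ rⁿ ω`. Hence
the kernel at `z` is `k(z̄ζ)` with `k(w) = ∑ aₙ wⁿ`, `aₙ = 1/(2 ω_{2n+1})`, and all estimates
concern the moments. Upper doubling makes moments and tails comparable: `ω_{j+1} ≤ D ω_{2j+1}`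
(`moment_le_of_tail_le`) and `ω_{N+1} ≤ C ω̂(r)` when `N ≥ 1/(1-r)` (`exists_moment_le_tail`).

Necessity (`lowerDoubling_of_bounded`). Test on `f = arg ζ / ν̂(ζ)`. The Fourier coefficients of the
angle are of size `1/n` with alternating sign, so at `-x` all terms of `P_ω f` have the same phase
and `∑ 2 aₙ xⁿ Wₙ / n ≤ B / ν̂(x)`, with `Wₙ = ∫ r^{n+1} ω/ν̂ ≥ x^{n+1} ω̂(x)/ν̂(x)`. The factor
`ν̂(x)` cancels, whatever `ν` is. Over a range `N < n ≤ 2^L N` with `N ≈ 1/(1-r)` and `1-x =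
(1-r)/2^{L+2}`, the powers of `x` are bounded below, `2 aₙ ≥ 1/ω_{2N+1} ≳ 1/ω̂(r)`, and the harmonic
sum is at least `L/2`. So `L ω̂(x) ≲ ω̂(r)` with a constant independent of `L`, which is lower
doubling once `L` is large.

Sufficiency (`bergmanProjectionBounded_sqrtTailWeight`). Take `ν = ω/(2√ω̂)`, so `ν̂ = √ω̂` and `|f
ω| ≤ 2‖f‖ν`. The circle means of `|k'|` are at most `C/((1-ρ) ω̂(ρ))`
(`exists_integral_norm_kernelSeriesDeriv_le`), by Cauchy–Schwarz and Parseval applied to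
`(1-w)k'(w)`. Integrating against `ν` gives `|(P_ω f)'(z)| ≲ ‖f‖/((1-|z|)√ω̂(z))`
(`exists_norm_deriv_le`). Lower doubling turns this into `|P_ω f| ≲ ‖f‖/√ω̂`
(`exists_growth_bound`): a step outward along a radius that divides `1-|z|` by `K` multiplies `|P_ω
f|√ω̂` by at most `1 + O(1)/|P_ω f|√ω̂`, times a factor below one, so the quantity stays bounded. -/

open MeasureTheory Set Filter Topology

/-! ### Polar coordinates for the normalized area measure. -/

/-- The measure `r/π dr dθ` on `(0,1) × (-π,π)`. -/
noncomputable def polarMeasure : Measure (ℝ × ℝ) :=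
  ((volume.restrict (Ioo (0 : ℝ) 1)).withDensity fun r => ENNReal.ofReal (r / Real.pi)).prod
    (volume.restrict (Ioo (-Real.pi) Real.pi))

theorem continuous_complex_polarCoord_symm : Continuous Complex.polarCoord.symm := by
  have : (Complex.polarCoord.symm : ℝ × ℝ → ℂ) =
      fun p => p.1 * (Real.cos p.2 + Real.sin p.2 * Complex.I) := by
    ext p; simp
  rw [this]; fun_prop

theorem measurePreserving_polarCoord_symm :
    MeasurePreserving Complex.polarCoord.symm polarMeasure discArea := by
  refine ⟨continuous_complex_polarCoord_symm.measurable, ?_⟩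
  ext s hs
  rw [Measure.map_apply continuous_complex_polarCoord_symm.measurable hs]
  have hms := continuous_complex_polarCoord_symm.measurable hs
  rw [← lintegral_indicator_one hms, polarMeasure, prod_withDensity_left (by fun_prop),
    lintegral_withDensity_eq_lintegral_mul _ (by fun_prop) (measurable_one.indicator hms),
    Measure.prod_restrict, ← Measure.volume_eq_prod]
  rw [discArea, Measure.smul_apply, Measure.restrict_apply hs,
    ← lintegral_indicator_one (hs.inter measurableSet_ball),
    ← Complex.lintegral_comp_polarCoord_symm, smul_eq_mul, ← lintegral_const_mul' _ _ (by simp)]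
  rw [← lintegral_indicator (measurableSet_Ioo.prod measurableSet_Ioo),
    ← lintegral_indicator (polarCoord.open_target.measurableSet)]
  congr 1
  ext ⟨r, θ⟩
  by_cases h : (r, θ) ∈ Ioo (0 : ℝ) 1 ×ˢ Ioo (-Real.pi) Real.pi
  · have h1 : (r, θ) ∈ polarCoord.target := ⟨h.1.1, h.2⟩
    have h2 : Complex.polarCoord.symm (r, θ) ∈ Metric.ball (0 : ℂ) 1 := by
      rw [mem_ball_zero_iff, Complex.norm_polarCoord_symm, abs_of_pos h.1.1]; exact h.1.2
    have h3 : 0 ≤ r := h.1.1.le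
    rw [indicator_of_mem h, indicator_of_mem h1]
    by_cases h4 : Complex.polarCoord.symm (r, θ) ∈ s
    · rw [indicator_of_mem (show _ ∈ s ∩ _ from ⟨h4, h2⟩)]
      simp only [Pi.mul_apply]
      rw [indicator_of_mem (show (r, θ) ∈ _ ⁻¹' s from h4)]
      simp only [Pi.one_apply, mul_one, smul_eq_mul]
      rw [← ENNReal.ofReal_mul (by positivity)]
      congr 1; ring
    · rw [indicator_of_notMem (fun h => h4 h.1)]
      simp only [Pi.mul_apply]
      rw [indicator_of_notMem (show (r, θ) ∉ _ ⁻¹' s from h4)]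
      simp
  · rw [indicator_of_notMem h]
    by_cases h1 : (r, θ) ∈ polarCoord.target
    · rw [indicator_of_mem h1, indicator_of_notMem, smul_zero, mul_zero]
      intro h2
      apply h
      have := h2.2
      rw [mem_ball_zero_iff, Complex.norm_polarCoord_symm, abs_of_pos h1.1] at this
      exact ⟨⟨h1.1, this⟩, h1.2⟩
    · rw [indicator_of_notMem h1]

/-- Transfers almost everywhere measurability of a radial profile on `(0,1)` to the disc, since `ω`
is not assumed Borel. -/
theorem quasiMeasurePreserving_norm :
    Measure.QuasiMeasurePreserving (fun ζ : ℂ => ‖ζ‖) discArea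
      (volume.restrict (Ioo (0 : ℝ) 1)) := by
  refine ⟨measurable_norm, ?_⟩
  rw [← measurePreserving_polarCoord_symm.map_eq,
    Measure.map_map measurable_norm continuous_complex_polarCoord_symm.measurable]
  have h : (fun ζ : ℂ => ‖ζ‖) ∘ Complex.polarCoord.symm = fun p : ℝ × ℝ => |p.1| := by
    ext p; exact Complex.norm_polarCoord_symm p
  rw [h]
  have h2 : (fun p : ℝ × ℝ => |p.1|) =ᵐ[polarMeasure] Prod.fst := by
    have : ∀ᵐ r ∂((volume.restrict (Ioo (0 : ℝ) 1)).withDensity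
        fun r => ENNReal.ofReal (r / Real.pi)), |r| = r := by
      refine (withDensity_absolutelyContinuous _ _).ae_le ?_
      filter_upwards [ae_restrict_mem measurableSet_Ioo] with r hr using abs_of_pos hr.1
    exact Measure.quasiMeasurePreserving_fst.ae this
  rw [Measure.map_congr h2]
  exact (Measure.quasiMeasurePreserving_fst.absolutelyContinuous).trans
    (withDensity_absolutelyContinuous _ _)

instance : SFinite polarMeasure := by unfold polarMeasure; infer_instance

instance : IsFiniteMeasure discArea := by
  unfold discArea
  have : IsFiniteMeasure (volume.restrict (Metric.ball (0 : ℂ) 1)) :=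
    ⟨by rw [Measure.restrict_apply_univ]; exact measure_ball_lt_top⟩
  exact Measure.smul_finite _ (by simp)

theorem ae_discArea_mem_ball : ∀ᵐ ζ ∂discArea, ζ ∈ Metric.ball (0 : ℂ) 1 :=
  Measure.ae_smul_measure (ae_restrict_mem measurableSet_ball) _

/-- Integration in polar coordinates over the disc. -/
theorem integral_discArea_smul {E : Type*} [NormedAddCommGroup E] [NormedSpace ℝ E] {F : ℂ → E}
    (hF : Integrable F discArea) :
    ∫ ζ, F ζ ∂discArea = ∫ r in Ioo (0 : ℝ) 1, (r / Real.pi) •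
      ∫ θ in Ioo (-Real.pi) Real.pi, F (Complex.polarCoord.symm (r, θ)) := by
  have hm := measurePreserving_polarCoord_symm
  rw [← hm.map_eq, integral_map hm.measurable.aemeasurable (by rw [hm.map_eq]; exact hF.1)]
  have h1 : Integrable (fun p => F (Complex.polarCoord.symm p)) polarMeasure :=
    hm.integrable_comp_of_integrable hF
  rw [polarMeasure, integral_prod _ h1]
  have := integral_withDensity_eq_integral_toReal_smul (μ := volume.restrict (Ioo (0 : ℝ) 1))
    (f := fun r => ENNReal.ofReal (r / Real.pi)) (by fun_prop) (by simp)
    (fun r => ∫ θ in Ioo (-Real.pi) Real.pi, F (Complex.polarCoord.symm (r, θ)))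
  rw [this]
  refine setIntegral_congr_fun measurableSet_Ioo fun r hr => ?_
  have : 0 ≤ r / Real.pi := div_nonneg hr.1.le Real.pi_pos.le
  simp only [ENNReal.toReal_ofReal this]

theorem integral_discArea {F : ℂ → ℂ} (hF : Integrable F discArea) :
    ∫ ζ, F ζ ∂discArea = ∫ r in Ioo (0 : ℝ) 1, ((r / Real.pi : ℝ) : ℂ) *
      ∫ θ in Ioo (-Real.pi) Real.pi, F (Complex.polarCoord.symm (r, θ)) := by
  simp_rw [integral_discArea_smul hF, Complex.real_smul]

theorem lintegral_discArea_le {F : ℂ → ENNReal} (hF : AEMeasurable F discArea) :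
    ∫⁻ ζ, F ζ ∂discArea ≤ ∫⁻ r in Ioo (0 : ℝ) 1, ENNReal.ofReal (r / Real.pi) *
      ∫⁻ θ in Ioo (-Real.pi) Real.pi, F (Complex.polarCoord.symm (r, θ)) := by
  have hm := measurePreserving_polarCoord_symm
  rw [← hm.map_eq, lintegral_map' (by rw [hm.map_eq]; exact hF) hm.measurable.aemeasurable]
  refine (lintegral_prod_le _).trans (le_of_eq ?_)
  exact lintegral_withDensity_eq_lintegral_mul_non_measurable _ (by fun_prop)
    (by simp) _

theorem integrable_radial {E : Type*} [NormedAddCommGroup E] [NormedSpace ℝ E] {h : ℝ → E}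
    (hh : IntegrableOn h (Ioo 0 1)) :
    Integrable (fun ζ : ℂ => h ‖ζ‖) discArea := by
  refine ⟨hh.1.comp_quasiMeasurePreserving quasiMeasurePreserving_norm, ?_⟩
  have hm : AEMeasurable (fun ζ : ℂ => ‖h ‖ζ‖‖ₑ) discArea :=
    (hh.1.comp_quasiMeasurePreserving quasiMeasurePreserving_norm).enorm
  refine lt_of_le_of_lt (lintegral_discArea_le hm) ?_
  have : ∀ r ∈ Ioo (0 : ℝ) 1, ENNReal.ofReal (r / Real.pi) *
      ∫⁻ θ in Ioo (-Real.pi) Real.pi, ‖h ‖Complex.polarCoord.symm (r, θ)‖‖ₑ ≤ 2 * ‖h r‖ₑ := by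
    intro r hr
    simp only [Complex.norm_polarCoord_symm, abs_of_pos hr.1, lintegral_const,
      Measure.restrict_apply_univ, Real.volume_Ioo]
    rw [mul_left_comm, ← ENNReal.ofReal_mul (div_nonneg hr.1.le Real.pi_pos.le), mul_comm]
    gcongr
    rw [show (2 : ENNReal) = ENNReal.ofReal 2 by simp]
    apply ENNReal.ofReal_le_ofReal
    have : r / Real.pi * (Real.pi - -Real.pi) = 2 * r := by field_simp; ring
    rw [this]; linarith [hr.2]
  refine lt_of_le_of_lt (setLIntegral_mono_ae' measurableSet_Ioo (.of_forall this)) ?_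
  rw [lintegral_const_mul' _ _ (by simp)]
  exact ENNReal.mul_lt_top (by simp) hh.2

/-! ### Tail integrals and moments of a radial weight. -/

/-- For `ω` merely integrable, `ω̂` is only absolutely continuous; this allows the fundamental
theorem of calculus for functions of `ω̂` such as `√ω̂` and `1/√ω̂`. -/
theorem AbsolutelyContinuousOnInterval.lipschitzOn_comp {f ψ : ℝ → ℝ} {a b : ℝ} {K : NNReal}
    (hf : AbsolutelyContinuousOnInterval f a b) (hψ : LipschitzOnWith K ψ (f '' uIcc a b)) :
    AbsolutelyContinuousOnInterval (fun x => ψ (f x)) a b := by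
  unfold AbsolutelyContinuousOnInterval at hf ⊢
  have h := hf.const_mul (K : ℝ)
  rw [mul_zero] at h
  refine tendsto_of_tendsto_of_tendsto_of_le_of_le' tendsto_const_nhds h
    (.of_forall fun E => Finset.sum_nonneg fun _ _ => dist_nonneg) ?_
  filter_upwards [mem_inf_of_right (mem_principal_self _)] with E hE
  rw [Finset.mul_sum]
  exact Finset.sum_le_sum fun i hi => hψ.dist_le_mul _ (mem_image_of_mem _ (hE.1 i hi).1) _
    (mem_image_of_mem _ (hE.1 i hi).2)

/-- The moment `∫_0^1 r^n ω(r) dr`. -/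
noncomputable def radialMoment (ω : ℝ → ℝ) (n : ℕ) : ℝ := ∫ r in (0 : ℝ)..1, r ^ n * ω r

namespace IsRadialWeight

variable {ω : ℝ → ℝ}

theorem integrableOn_Ioo (hω : IsRadialWeight ω) : IntegrableOn ω (Ioo 0 1) :=
  hω.integrable.mono_set Ioo_subset_Ico_self

theorem intervalIntegrable (hω : IsRadialWeight ω) : IntervalIntegrable ω volume 0 1 := by
  rw [intervalIntegrable_iff_integrableOn_Ioo_of_le zero_le_one]
  exact hω.integrableOn_Ioo

theorem intervalIntegrable_sub (hω : IsRadialWeight ω) {a b : ℝ} (ha : a ∈ Icc (0 : ℝ) 1)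
    (hb : b ∈ Icc (0 : ℝ) 1) : IntervalIntegrable ω volume a b :=
  hω.intervalIntegrable.mono_set (by
    rw [uIcc_of_le (zero_le_one : (0 : ℝ) ≤ 1)]; exact uIcc_subset_Icc ha hb)

theorem tail_sub (hω : IsRadialWeight ω) {a b : ℝ} (ha : a ∈ Icc (0 : ℝ) 1)
    (hb : b ∈ Icc (0 : ℝ) 1) : radialTail ω a - radialTail ω b = ∫ s in a..b, ω s := by
  unfold radialTail
  rw [sub_eq_iff_eq_add, intervalIntegral.integral_add_adjacent_intervals
    (hω.intervalIntegrable_sub ha hb) (hω.intervalIntegrable_sub hb (by simp))]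

theorem tail_one (ω : ℝ → ℝ) : radialTail ω 1 = 0 := by simp [radialTail]

theorem tail_antitone (hω : IsRadialWeight ω) : AntitoneOn (radialTail ω) (Icc 0 1) := by
  intro a ha b hb hab
  rw [← sub_nonneg, hω.tail_sub ha hb, ← intervalIntegral.integral_zero (a := a) (b := b)]
  refine intervalIntegral.integral_mono_on_of_le_Ioo hab (by simp)
    (hω.intervalIntegrable_sub ha hb) fun x hx => hω.nonneg x ⟨ha.1.trans hx.1.le, hx.2.trans_le hb.2⟩

theorem tail_nonneg (hω : IsRadialWeight ω) {r : ℝ} (hr : r ∈ Icc (0 : ℝ) 1) :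
    0 ≤ radialTail ω r := by
  rw [← tail_one ω]; exact hω.tail_antitone hr (by simp) hr.2

theorem tail_absolutelyContinuous (hω : IsRadialWeight ω) :
    AbsolutelyContinuousOnInterval (radialTail ω) 0 1 := by
  have h := (hω.intervalIntegrable.absolutelyContinuousOnInterval_intervalIntegral
    (c := 1) (by simp)).neg
  convert! h using 1
  ext r
  exact intervalIntegral.integral_symm 1 r

theorem tail_continuousOn (hω : IsRadialWeight ω) : ContinuousOn (radialTail ω) (Icc 0 1) := by
  have := hω.tail_absolutelyContinuous.continuousOn
  rwa [uIcc_of_le zero_le_one] at this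

theorem ae_hasDerivAt_tail (hω : IsRadialWeight ω) :
    ∀ᵐ x, x ∈ Icc (0 : ℝ) 1 → HasDerivAt (radialTail ω) (-ω x) x := by
  filter_upwards [hω.intervalIntegrable.ae_hasDerivAt_integral] with x hx hx'
  rw [uIcc_of_le zero_le_one] at hx
  have := (hx hx' 1 (by simp)).neg
  convert! this using 1
  ext r
  exact intervalIntegral.integral_symm 1 r

/-- The chain rule for the tail integral, in integrated form. -/
theorem integral_mul_comp_tail (hω : IsRadialWeight ω) {a b : ℝ} (ha : 0 ≤ a) (hab : a ≤ b)
    (hb : b ≤ 1) {ψ ψ' : ℝ → ℝ}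
    (hψ : ∀ y ∈ Icc (radialTail ω b) (radialTail ω a), HasDerivAt ψ (ψ' y) y)
    (hψ' : ContinuousOn ψ' (Icc (radialTail ω b) (radialTail ω a))) :
    ∫ r in a..b, ω r * ψ' (radialTail ω r) = ψ (radialTail ω a) - ψ (radialTail ω b) := by
  have hsub : Icc a b ⊆ Icc 0 1 := Icc_subset_Icc ha hb
  have hmem : ∀ r ∈ Icc a b, radialTail ω r ∈ Icc (radialTail ω b) (radialTail ω a) := fun r hr =>
    ⟨hω.tail_antitone (hsub hr) ⟨ha.trans hab, hb⟩ hr.2,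
      hω.tail_antitone ⟨ha, hab.trans hb⟩ (hsub hr) hr.1⟩
  obtain ⟨K, hK⟩ := (isCompact_Icc.image_of_continuousOn hψ').isBounded.exists_norm_le
  have hlip : LipschitzOnWith K.toNNReal ψ (Icc (radialTail ω b) (radialTail ω a)) := by
    refine Convex.lipschitzOnWith_of_nnnorm_hasDerivWithin_le (convex_Icc _ _)
      (fun y hy => (hψ y hy).hasDerivWithinAt) fun y hy => ?_
    rw [← NNReal.coe_le_coe, coe_nnnorm]
    exact (hK _ (mem_image_of_mem _ hy)).trans (Real.le_coe_toNNReal K)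
  -- `ψ'` is bounded on the compact range of `ω̂`, so `ψ` is Lipschitz there and `ψ ∘ ω̂` is the
  -- integral of its almost everywhere derivative.
  have hac := (hω.tail_absolutelyContinuous.mono (c := a) (d := b) (by
    rw [uIcc_of_le hab, uIcc_of_le zero_le_one]; exact hsub)).lipschitzOn_comp
    (hlip.mono (by
      rw [uIcc_of_le hab]; rintro _ ⟨r, hr, rfl⟩; exact hmem r hr))
  have h := hac.integral_deriv_eq_sub
  rw [← neg_sub, ← h, ← intervalIntegral.integral_neg]
  refine intervalIntegral.integral_congr_ae ?_
  filter_upwards [hω.ae_hasDerivAt_tail] with x hx hx'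
  rw [uIoc_of_le hab] at hx'
  have hx2 : x ∈ Icc a b := Ioc_subset_Icc_self hx'
  have := (hψ _ (hmem x hx2)).comp x (hx (hsub hx2))
  rw [show (fun x => ψ (radialTail ω x)) = ψ ∘ radialTail ω from rfl, this.deriv]
  ring

theorem moment_intervalIntegrable (hω : IsRadialWeight ω) (n : ℕ) :
    IntervalIntegrable (fun r => r ^ n * ω r) volume 0 1 :=
  hω.intervalIntegrable.continuousOn_mul (by fun_prop)

theorem moment_antitone (hω : IsRadialWeight ω) : Antitone (radialMoment ω) := by
  intro m n hmn
  refine intervalIntegral.integral_mono_on_of_le_Ioo zero_le_one (hω.moment_intervalIntegrable n)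
    (hω.moment_intervalIntegrable m) fun x hx => ?_
  exact mul_le_mul_of_nonneg_right (pow_le_pow_of_le_one hx.1.le hx.2.le hmn)
    (hω.nonneg x ⟨hx.1.le, hx.2⟩)

theorem pow_mul_tail_le_moment (hω : IsRadialWeight ω) {t : ℝ} (ht : t ∈ Icc (0 : ℝ) 1) (n : ℕ) :
    t ^ n * radialTail ω t ≤ radialMoment ω n := by
  have h1 : t ^ n * radialTail ω t ≤ ∫ r in t..1, r ^ n * ω r := by
    unfold radialTail
    rw [← intervalIntegral.integral_const_mul]
    refine intervalIntegral.integral_mono_on_of_le_Ioo ht.2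
      ((hω.intervalIntegrable_sub ht (by simp)).const_mul _)
      ((hω.intervalIntegrable_sub ht (by simp)).continuousOn_mul (by fun_prop)) fun x hx => ?_
    exact mul_le_mul_of_nonneg_right (pow_le_pow_left₀ ht.1 hx.1.le n)
      (hω.nonneg x ⟨ht.1.trans hx.1.le, hx.2⟩)
  refine h1.trans ?_
  unfold radialMoment
  have h0 : IntervalIntegrable (fun r => r ^ n * ω r) volume 0 t :=
    (hω.intervalIntegrable_sub (by simp) ht).continuousOn_mul (by fun_prop)
  rw [← intervalIntegral.integral_add_adjacent_intervals h0
    ((hω.intervalIntegrable_sub ht (by simp)).continuousOn_mul (by fun_prop))]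
  have : 0 ≤ ∫ r in (0 : ℝ)..t, r ^ n * ω r := by
    have h := intervalIntegral.integral_mono_on_of_le_Ioo ht.1 (f := fun _ => (0 : ℝ)) (by simp) h0
      fun x hx => mul_nonneg (pow_nonneg hx.1.le n) (hω.nonneg x ⟨hx.1.le, hx.2.trans_le ht.2⟩)
    simpa using h
  linarith

theorem moment_pos (hω : IsRadialWeight ω) (n : ℕ) : 0 < radialMoment ω n :=
  (mul_pos (by positivity) (hω.tail_pos (1 / 2) (by norm_num))).trans_le
    (hω.pow_mul_tail_le_moment (t := 1 / 2) (by norm_num) n)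

/-- Cut at `t`: below it `r^m ≤ t^m`, above it `r^(m+n) ≤ 1`. -/
theorem moment_le_split (hω : IsRadialWeight ω) {t : ℝ} (ht : t ∈ Icc (0 : ℝ) 1) (m n : ℕ) :
    radialMoment ω (m + n) ≤ t ^ m * radialMoment ω n + radialTail ω t := by
  unfold radialMoment radialTail
  have hi : ∀ k : ℕ, ∀ a ∈ Icc (0 : ℝ) 1, ∀ b ∈ Icc (0 : ℝ) 1,
      IntervalIntegrable (fun r => r ^ k * ω r) volume a b := fun k a ha b hb =>
    (hω.intervalIntegrable_sub ha hb).continuousOn_mul (by fun_prop)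
  have z0 : (0 : ℝ) ∈ Icc (0 : ℝ) 1 := by simp
  have z1 : (1 : ℝ) ∈ Icc (0 : ℝ) 1 := by simp
  rw [← intervalIntegral.integral_add_adjacent_intervals (hi (m + n) 0 z0 t ht) (hi _ t ht 1 z1),
    ← intervalIntegral.integral_add_adjacent_intervals (hi n 0 z0 t ht) (hi _ t ht 1 z1)]
  have h1 : ∫ r in (0 : ℝ)..t, r ^ (m + n) * ω r ≤ t ^ m * ∫ r in (0 : ℝ)..t, r ^ n * ω r := by
    rw [← intervalIntegral.integral_const_mul]
    refine intervalIntegral.integral_mono_on_of_le_Ioo ht.1 (hi _ 0 z0 t ht)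
      ((hi n 0 z0 t ht).const_mul _) fun x hx => ?_
    have := hω.nonneg x ⟨hx.1.le, hx.2.trans_le ht.2⟩
    rw [pow_add, mul_assoc]
    exact mul_le_mul_of_nonneg_right (pow_le_pow_left₀ hx.1.le hx.2.le m)
      (mul_nonneg (pow_nonneg hx.1.le n) this)
  have h2 : ∫ r in t..1, r ^ (m + n) * ω r ≤ ∫ r in t..1, ω r := by
    refine intervalIntegral.integral_mono_on_of_le_Ioo ht.2 (hi _ t ht 1 z1)
      (hω.intervalIntegrable_sub ht z1) fun x hx => ?_
    have h0 : 0 ≤ x := ht.1.trans hx.1.le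
    exact mul_le_of_le_one_left (hω.nonneg x ⟨h0, hx.2⟩) (pow_le_one₀ h0 hx.2.le)
  have h3 : 0 ≤ ∫ r in t..1, r ^ n * ω r := by
    rw [← intervalIntegral.integral_zero (a := t) (b := 1)]
    refine intervalIntegral.integral_mono_on_of_le_Ioo ht.2 (by simp) (hi _ t ht 1 z1) fun x hx => ?_
    have h0 : 0 ≤ x := ht.1.trans hx.1.le
    exact mul_nonneg (pow_nonneg h0 n) (hω.nonneg x ⟨h0, hx.2⟩)
  nlinarith [pow_nonneg ht.1 m, mul_nonneg (pow_nonneg ht.1 m) h3]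

theorem moment_succ_eq (hω : IsRadialWeight ω) (n : ℕ) :
    radialMoment ω (n + 1) = ∫ s in (0 : ℝ)..1, (n + 1) * s ^ n * radialTail ω s := by
  have hp : AbsolutelyContinuousOnInterval (fun s : ℝ => s ^ (n + 1)) 0 1 :=
    ContDiffOn.absolutelyContinuousOnInterval (by fun_prop)
  have h := hp.integral_mul_deriv_eq_deriv_mul hω.tail_absolutelyContinuous
  rw [tail_one] at h
  have h1 : ∫ x in (0 : ℝ)..1, x ^ (n + 1) * deriv (radialTail ω) x = - radialMoment ω (n + 1) := by
    unfold radialMoment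
    rw [← intervalIntegral.integral_neg]
    refine intervalIntegral.integral_congr_ae ?_
    filter_upwards [hω.ae_hasDerivAt_tail] with x hx hx'
    rw [uIoc_of_le zero_le_one] at hx'
    rw [(hx (Ioc_subset_Icc_self hx')).deriv]; ring
  have h2 : ∫ x in (0 : ℝ)..1, deriv (fun s : ℝ => s ^ (n + 1)) x * radialTail ω x =
      ∫ s in (0 : ℝ)..1, (n + 1) * s ^ n * radialTail ω s := by
    congr 1; ext x; simp
  rw [h1, h2] at h
  simp at h
  linarith

/-- Away from `1` the tails at `(1+r)/2` are bounded below by a positive constant, so enlarging the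
constant extends doubling from a neighbourhood of `1` to the whole interval. -/
theorem exists_tail_le (hω : IsRadialWeight ω) (hD : UpperDoubling ω) :
    ∃ C : ℝ, 1 ≤ C ∧ ∀ r ∈ Icc (0 : ℝ) 1, radialTail ω r ≤ C * radialTail ω ((1 + r) / 2) := by
  obtain ⟨C, hC, hev⟩ := hD
  obtain ⟨r₀, hr₀, h⟩ := (mem_nhdsLT_iff_exists_Ioo_subset).1 hev
  set a := max r₀ 0
  have ha : a ∈ Ico (0 : ℝ) 1 := ⟨le_max_right _ _, max_lt hr₀ one_pos⟩
  set b := (1 + a) / 2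
  have hb : b ∈ Ico (0 : ℝ) 1 := ⟨by have := ha.1; positivity, by have := ha.2; simp only [b]; linarith⟩
  have hTb := hω.tail_pos b hb
  refine ⟨max 1 (max C (radialTail ω 0 / radialTail ω b)), le_max_left _ _, fun r hr => ?_⟩
  have hr' : (1 + r) / 2 ∈ Icc (0 : ℝ) 1 := ⟨by have := hr.1; positivity, by have := hr.2; linarith⟩
  have hT := hω.tail_nonneg hr'
  rcases eq_or_lt_of_le hr.2 with h1 | h1
  · subst h1; simp [tail_one]
  by_cases hra : a < r
  · have := h ⟨(le_max_left _ _).trans_lt hra, h1⟩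
    simp only [mem_ofPred_eq] at this
    exact this.trans (mul_le_mul_of_nonneg_right
      ((le_max_left _ _).trans (le_max_right _ _)) hT)
  · push Not at hra
    have h2 : radialTail ω b ≤ radialTail ω ((1 + r) / 2) :=
      hω.tail_antitone hr' ⟨hb.1, hb.2.le⟩ (by simp only [b]; linarith)
    have h3 : radialTail ω r ≤ radialTail ω 0 := hω.tail_antitone (by simp) hr hr.1
    have h0 := hω.tail_pos 0 (by simp)
    calc radialTail ω r ≤ radialTail ω 0 / radialTail ω b * radialTail ω b := by
          rw [div_mul_cancel₀ _ hTb.ne']; exact h3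
      _ ≤ _ := mul_le_mul ((le_max_right _ _).trans (le_max_right _ _)) h2 hTb.le (by positivity)

/-- Integration by parts writes moments as integrals of `ω̂`. Doubling and the substitution `u =
(1+s)/2` turn `s^j` into `(2u-1)^j`, and `2u-1 ≤ u²` doubles the exponent. -/
theorem moment_le_of_tail_le (hω : IsRadialWeight ω) {C : ℝ} (hC0 : 0 ≤ C)
    (hC : ∀ r ∈ Icc (0 : ℝ) 1, radialTail ω r ≤ C * radialTail ω ((1 + r) / 2)) (j : ℕ) :
    radialMoment ω (j + 1) ≤ 2 * C * radialMoment ω (2 * j + 1) := by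
  rw [hω.moment_succ_eq j, hω.moment_succ_eq (2 * j)]
  have hcont : ∀ f : ℝ → ℝ, Continuous f → ∀ a ∈ Icc (0 : ℝ) 1, ∀ b ∈ Icc (0 : ℝ) 1,
      IntervalIntegrable (fun s => f s * radialTail ω s) volume a b := fun f hf a ha b hb =>
    ContinuousOn.intervalIntegrable (hf.continuousOn.mul
      (hω.tail_continuousOn.mono (uIcc_subset_Icc ha hb)))
  have z0 : (0 : ℝ) ∈ Icc (0 : ℝ) 1 := by simp
  have z1 : (1 : ℝ) ∈ Icc (0 : ℝ) 1 := by simp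
  have zh : (1 / 2 : ℝ) ∈ Icc (0 : ℝ) 1 := by norm_num
  have hpos : (0 : ℝ) ≤ j + 1 := by positivity
  have hcomp : ∫ s in (0 : ℝ)..1, ((j : ℝ) + 1) * s ^ j * radialTail ω ((1 + s) / 2) =
      2 * ∫ u in (1 / 2 : ℝ)..1, ((j : ℝ) + 1) * (2 * u - 1) ^ j * radialTail ω u := by
    have := intervalIntegral.integral_comp_mul_add (a := 0) (b := 1)
      (fun u : ℝ => ((j : ℝ) + 1) * (2 * u - 1) ^ j * radialTail ω u)
      (c := 1 / 2) (by norm_num) (1 / 2)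
    norm_num at this
    rw [← this]
    congr 1; ext s
    congr 2 <;> ring
  calc ∫ s in (0 : ℝ)..1, ((j : ℝ) + 1) * s ^ j * radialTail ω s
      ≤ ∫ s in (0 : ℝ)..1, C * (((j : ℝ) + 1) * s ^ j * radialTail ω ((1 + s) / 2)) := by
        refine intervalIntegral.integral_mono_on zero_le_one
          (hcont (fun s => ((j : ℝ) + 1) * s ^ j) (by fun_prop) 0 z0 1 z1) ?_ fun x hx => ?_
        · refine ContinuousOn.intervalIntegrable ?_
          rw [uIcc_of_le zero_le_one]
          refine continuousOn_const.mul (ContinuousOn.mul (by fun_prop) ?_)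
          exact hω.tail_continuousOn.comp (by fun_prop) fun x hx =>
            ⟨by have := hx.1; positivity, by have := hx.2; linarith⟩
        · have := mul_le_mul_of_nonneg_left (hC x hx) (mul_nonneg hpos (pow_nonneg hx.1 j))
          linarith
    _ = 2 * C * ∫ u in (1 / 2 : ℝ)..1, ((j : ℝ) + 1) * (2 * u - 1) ^ j * radialTail ω u := by
        rw [intervalIntegral.integral_const_mul, hcomp]; ring
    _ ≤ 2 * C * ∫ u in (1 / 2 : ℝ)..1,
          (((2 * j : ℕ) : ℝ) + 1) * u ^ (2 * j) * radialTail ω u := by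
        refine mul_le_mul_of_nonneg_left ?_ (by positivity)
        refine intervalIntegral.integral_mono_on (by norm_num)
          (hcont (fun u => ((j : ℝ) + 1) * (2 * u - 1) ^ j) (by fun_prop) _ zh 1 z1)
          (hcont (fun u => (((2 * j : ℕ) : ℝ) + 1) * u ^ (2 * j)) (by fun_prop) _ zh 1 z1)
          fun x hx => ?_
        have hx0 : 0 ≤ 2 * x - 1 := by linarith [hx.1]
        refine mul_le_mul_of_nonneg_right ?_ (hω.tail_nonneg ⟨by linarith [hx.1], hx.2⟩)
        refine mul_le_mul (by push_cast; linarith [(Nat.cast_nonneg j : (0 : ℝ) ≤ j)]) ?_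
          (pow_nonneg hx0 j) (by positivity)
        rw [pow_mul]
        exact pow_le_pow_left₀ hx0 (by nlinarith [sq_nonneg (x - 1)]) j
    _ ≤ _ := by
        refine mul_le_mul_of_nonneg_left ?_ (by positivity)
        have hc := hcont (fun u => (((2 * j : ℕ) : ℝ) + 1) * u ^ (2 * j)) (by fun_prop)
        rw [← intervalIntegral.integral_add_adjacent_intervals (hc 0 z0 _ zh) (hc _ zh 1 z1)]
        refine le_add_of_nonneg_left ?_
        refine intervalIntegral.integral_nonneg (by norm_num) fun x hx => ?_
        exact mul_nonneg (mul_nonneg (by positivity) (pow_nonneg hx.1 _))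
          (hω.tail_nonneg ⟨hx.1, by linarith [hx.2]⟩)

end IsRadialWeight

/-! ### Absolutely convergent power series on circles: orthogonality, Parseval, `L¹` means. -/

theorem polarCoord_symm_eq_mul_exp (r θ : ℝ) :
    Complex.polarCoord.symm (r, θ) = r * Complex.exp (θ * Complex.I) := by
  rw [Complex.polarCoord_symm_apply, Complex.exp_mul_I]; simp

theorem integral_exp_pow_mul_conj (n m : ℕ) :
    ∫ θ in Ioo (-Real.pi) Real.pi, Complex.exp (θ * Complex.I) ^ n *
      (starRingEnd ℂ) (Complex.exp (θ * Complex.I)) ^ m = if n = m then 2 * (Real.pi : ℂ) else 0 := by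
  have hpi : -Real.pi ≤ Real.pi := by linarith [Real.pi_pos]
  have h : ∀ θ : ℝ, Complex.exp (θ * Complex.I) ^ n *
      (starRingEnd ℂ) (Complex.exp (θ * Complex.I)) ^ m =
      Complex.exp (((n : ℂ) - m) * Complex.I * θ) := by
    intro θ
    rw [← Complex.exp_conj, ← Complex.exp_nat_mul, ← Complex.exp_nat_mul, ← Complex.exp_add]
    congr 1
    simp
    ring
  simp_rw [h]
  rw [← integral_Ioc_eq_integral_Ioo, ← intervalIntegral.integral_of_le hpi]
  split_ifs with hnm
  · subst hnm
    simp
    ring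
  · have hc : ((n : ℂ) - m) * Complex.I ≠ 0 :=
      mul_ne_zero (sub_ne_zero.2 (by exact_mod_cast hnm)) Complex.I_ne_zero
    rw [integral_exp_mul_complex hc, div_eq_zero_iff]
    left
    rw [sub_eq_zero, Complex.exp_eq_exp_iff_exists_int]
    refine ⟨(n : ℤ) - m, ?_⟩
    push_cast
    ring

theorem norm_exp_pow (θ : ℝ) (n : ℕ) : ‖Complex.exp (θ * Complex.I) ^ n‖ = 1 := by
  rw [norm_pow, Complex.norm_exp_ofReal_mul_I, one_pow]

theorem continuous_tsum_exp {c : ℕ → ℂ} (hc : Summable fun n => ‖c n‖) :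
    Continuous fun θ : ℝ => ∑' n, c n * Complex.exp (θ * Complex.I) ^ n := by
  refine continuous_tsum (fun n => by fun_prop) hc fun n θ => ?_
  rw [norm_mul, norm_exp_pow, mul_one]

theorem norm_tsum_exp_le {c : ℕ → ℂ} (hc : Summable fun n => ‖c n‖) (θ : ℝ) :
    ‖∑' n, c n * Complex.exp (θ * Complex.I) ^ n‖ ≤ ∑' n, ‖c n‖ := by
  refine tsum_of_norm_bounded hc.hasSum fun n => ?_
  rw [norm_mul, norm_exp_pow, mul_one]

theorem integrableOn_of_continuous_Ioo {E : Type*} [NormedAddCommGroup E] {f : ℝ → E}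
    (hf : Continuous f) (a b : ℝ) : IntegrableOn f (Ioo a b) :=
  (hf.integrableOn_Icc (a := a) (b := b)).mono_set Ioo_subset_Icc_self

theorem setIntegral_Ioo_le_const {g : ℝ → ℝ} {B : ℝ} (hB : ∀ θ, ‖g θ‖ ≤ B) :
    ‖∫ θ in Ioo (-Real.pi) Real.pi, g θ‖ ≤ B * (2 * Real.pi) := by
  have := norm_setIntegral_le_of_norm_le_const (μ := volume) (s := Ioo (-Real.pi) Real.pi)
    (f := g) (C := B) (by simp) (fun θ _ => hB θ)
  refine this.trans (le_of_eq ?_)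
  rw [measureReal_def, Real.volume_Ioo, ENNReal.toReal_ofReal (by linarith [Real.pi_pos])]
  ring

theorem hasSum_integral_mul_exp {c : ℕ → ℂ} (hc : Summable fun n => ‖c n‖) {g : ℝ → ℂ}
    (hg : Continuous g) {B : ℝ} (hB : ∀ θ, ‖g θ‖ ≤ B) :
    HasSum (fun n => ∫ θ in Ioo (-Real.pi) Real.pi, c n * Complex.exp (θ * Complex.I) ^ n * g θ)
      (∫ θ in Ioo (-Real.pi) Real.pi, (∑' n, c n * Complex.exp (θ * Complex.I) ^ n) * g θ) := by
  simp_rw [← tsum_mul_right]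
  refine hasSum_integral_of_summable_integral_norm
    (fun n => integrableOn_of_continuous_Ioo (by fun_prop) _ _) ?_
  refine Summable.of_norm_bounded (g := fun n => ‖c n‖ * (B * (2 * Real.pi))) (hc.mul_right _)
    fun n => ?_
  rw [← mul_assoc]
  refine setIntegral_Ioo_le_const fun θ => ?_
  rw [norm_norm, norm_mul, norm_mul, norm_exp_pow, mul_one]
  exact mul_le_mul_of_nonneg_left (hB θ) (norm_nonneg _)

theorem integral_tsum_exp_mul_conj {c : ℕ → ℂ} (hc : Summable fun n => ‖c n‖) (m : ℕ) :
    ∫ θ in Ioo (-Real.pi) Real.pi, (∑' n, c n * Complex.exp (θ * Complex.I) ^ n) *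
      (starRingEnd ℂ) (Complex.exp (θ * Complex.I)) ^ m = 2 * Real.pi * c m := by
  have h := hasSum_integral_mul_exp hc (g := fun θ =>
    (starRingEnd ℂ) (Complex.exp (θ * Complex.I)) ^ m)
    ((Complex.continuous_conj.comp (by fun_prop)).pow m) (B := 1) fun θ => by
      rw [← map_pow, RCLike.norm_conj, norm_exp_pow]
  simp_rw [mul_assoc, integral_const_mul, integral_exp_pow_mul_conj] at h
  rw [h.unique (hasSum_single m fun n hn => by simp [hn])]
  simp [mul_comm]

/-- Parseval's identity for absolutely convergent power series on the circle. -/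
theorem integral_norm_sq_tsum_exp {c : ℕ → ℂ} (hc : Summable fun n => ‖c n‖) :
    ∫ θ in Ioo (-Real.pi) Real.pi, ‖∑' n, c n * Complex.exp (θ * Complex.I) ^ n‖ ^ 2 =
      2 * Real.pi * ∑' n, ‖c n‖ ^ 2 := by
  set S : ℝ → ℂ := fun θ => ∑' n, c n * Complex.exp (θ * Complex.I) ^ n with hS
  have h := hasSum_integral_mul_exp hc (g := fun θ => (starRingEnd ℂ) (S θ))
    (Complex.continuous_conj.comp (continuous_tsum_exp hc)) (B := ∑' n, ‖c n‖) fun θ => by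
      rw [RCLike.norm_conj]; exact norm_tsum_exp_le hc θ
  have h1 : ∀ n, ∫ θ in Ioo (-Real.pi) Real.pi,
      c n * Complex.exp (θ * Complex.I) ^ n * (starRingEnd ℂ) (S θ) =
      ((2 * Real.pi * ‖c n‖ ^ 2 : ℝ) : ℂ) := by
    intro n
    have h2 : ∀ θ : ℝ, c n * Complex.exp (θ * Complex.I) ^ n * (starRingEnd ℂ) (S θ) =
        c n * (starRingEnd ℂ) (S θ * (starRingEnd ℂ) (Complex.exp (θ * Complex.I)) ^ n) := by
      intro θ
      rw [map_mul, map_pow, Complex.conj_conj]; ring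
    simp_rw [h2]
    rw [integral_const_mul, integral_conj, integral_tsum_exp_mul_conj hc n]
    simp only [map_mul, Complex.conj_ofReal, map_ofNat]
    push_cast
    rw [← Complex.mul_conj' (c n)]
    ring
  simp_rw [h1] at h
  have h3 : ∀ θ : ℝ, (∑' n, c n * Complex.exp (θ * Complex.I) ^ n) * (starRingEnd ℂ) (S θ) =
      ((‖S θ‖ ^ 2 : ℝ) : ℂ) := by
    intro θ
    rw [Complex.ofReal_pow, ← Complex.mul_conj' (S θ)]
  simp_rw [h3] at h
  rw [integral_complex_ofReal, Complex.hasSum_ofReal] at h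
  rw [← h.tsum_eq, tsum_mul_left]

/-- The `L¹` means of a power series are controlled by its coefficient differences. -/
theorem integral_norm_tsum_le {b d : ℕ → ℝ} (hd0 : d 0 = b 0) (hd : ∀ n, d (n + 1) = b (n + 1) - b n)
    {u : ℂ} (hu : ‖u‖ < 1) (hb : Summable fun n => |b n| * ‖u‖ ^ n) {l : ℝ} (hl : 0 < l) :
    ∫ θ in Ioo (-Real.pi) Real.pi, ‖∑' n, (b n : ℂ) * (u * Complex.exp (θ * Complex.I)) ^ n‖ ≤
      Real.pi * (l * ∑' n, d n ^ 2 * ‖u‖ ^ (2 * n) + l⁻¹ * (1 - ‖u‖)⁻¹) := by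
  have hb' : Summable fun n => ‖(b n : ℂ) * u ^ n‖ := by
    simpa [norm_mul, norm_pow] using hb
  have hd' : Summable fun n => ‖(d n : ℂ) * u ^ n‖ := by
    rw [← summable_nat_add_iff 1]
    refine Summable.of_norm_bounded (g := fun n => ‖(b (n + 1) : ℂ) * u ^ (n + 1)‖ +
      ‖(b n : ℂ) * u ^ n‖ * ‖u‖) (((summable_nat_add_iff 1).2 hb').add (hb'.mul_right _)) fun n => ?_
    rw [norm_norm, hd, Complex.ofReal_sub, sub_mul]
    refine (norm_sub_le _ _).trans (le_of_eq ?_)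
    rw [pow_succ, ← mul_assoc, ← mul_assoc, norm_mul _ u, norm_mul _ u]
  have hg : Summable fun n => ‖(1 : ℂ) * u ^ n‖ := by
    simpa [norm_pow] using summable_geometric_of_lt_one (norm_nonneg u) hu
  have hG := continuous_tsum_exp hb'
  have hD := continuous_tsum_exp hd'
  have hE := continuous_tsum_exp hg
  have hw : ∀ θ : ℝ, ‖u * Complex.exp (θ * Complex.I)‖ = ‖u‖ := fun θ => by
    rw [norm_mul, Complex.norm_exp_ofReal_mul_I, mul_one]
  have hpt : ∀ θ : ℝ, ‖∑' n, (b n : ℂ) * (u * Complex.exp (θ * Complex.I)) ^ n‖ ≤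
      l / 2 * ‖∑' n, (d n : ℂ) * u ^ n * Complex.exp (θ * Complex.I) ^ n‖ ^ 2 +
      l⁻¹ / 2 * ‖∑' n, (1 : ℂ) * u ^ n * Complex.exp (θ * Complex.I) ^ n‖ ^ 2 := by
    intro θ
    set w := u * Complex.exp (θ * Complex.I) with hwdef
    have hw1 : ‖w‖ < 1 := (hw θ).trans_lt hu
    have hsb : Summable fun n => (b n : ℂ) * w ^ n := by
      refine Summable.of_norm ?_
      simpa [norm_mul, norm_pow, hwdef, hw] using hb
    -- Multiplying by `1 - w` replaces coefficients by their differences.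
    have e1 : ∑' n, (d n : ℂ) * u ^ n * Complex.exp (θ * Complex.I) ^ n =
        (1 - w) * ∑' n, (b n : ℂ) * w ^ n := by
      have hsd : Summable fun n => (d n : ℂ) * w ^ n := by
        refine Summable.of_norm ?_
        simpa [norm_mul, norm_pow, hwdef, hw] using hd'
      have : ∀ n, (d n : ℂ) * u ^ n * Complex.exp (θ * Complex.I) ^ n = d n * w ^ n := by
        intro n; rw [hwdef, mul_pow]; ring
      simp_rw [this]
      rw [hsd.tsum_eq_zero_add, sub_mul, one_mul]
      nth_rewrite 1 [hsb.tsum_eq_zero_add]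
      rw [← tsum_mul_left, add_sub_assoc, ← ((summable_nat_add_iff 1).2 hsb).tsum_sub
        (hsb.mul_left w), hd0]
      congr 2
      ext n
      rw [hd]
      push_cast
      ring
    have e2 : ∑' n, (1 : ℂ) * u ^ n * Complex.exp (θ * Complex.I) ^ n = (1 - w)⁻¹ := by
      rw [← tsum_geometric_of_norm_lt_one hw1]
      congr 1; ext n; rw [hwdef, mul_pow, one_mul]
    rw [e1, e2, norm_mul, norm_inv]
    have hne : 0 < ‖1 - w‖ := by
      rw [norm_pos_iff, sub_ne_zero]
      rintro h
      rw [← h] at hw1; simp at hw1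
    set x := ‖1 - w‖
    set y := ‖∑' n, (b n : ℂ) * w ^ n‖
    have hxy : y = (x * y) * x⁻¹ := by field_simp
    have hll : l * l⁻¹ = 1 := mul_inv_cancel₀ hl.ne'
    -- The inequality `y = (xy)·x⁻¹ ≤ (l/2)(xy)² + (1/(2l)) x⁻²`. The free parameter `l` replaces
    -- the square roots of Cauchy–Schwarz.
    have key : 0 ≤ l⁻¹ / 2 * (l * (x * y) - x⁻¹) ^ 2 := by positivity
    have : l⁻¹ / 2 * (l * (x * y) - x⁻¹) ^ 2 =
        l / 2 * (x * y) ^ 2 + l⁻¹ / 2 * x⁻¹ ^ 2 - y := by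
      field_simp
      ring
    linarith
  calc _ ≤ ∫ θ in Ioo (-Real.pi) Real.pi,
        (l / 2 * ‖∑' n, (d n : ℂ) * u ^ n * Complex.exp (θ * Complex.I) ^ n‖ ^ 2 +
        l⁻¹ / 2 * ‖∑' n, (1 : ℂ) * u ^ n * Complex.exp (θ * Complex.I) ^ n‖ ^ 2) := by
        refine integral_mono (integrableOn_of_continuous_Ioo ?_ _ _)
          (integrableOn_of_continuous_Ioo (by fun_prop) _ _) hpt
        refine Continuous.norm ?_
        convert! hG using 4 with θ n
        rw [mul_pow]; ring
    _ = l / 2 * (2 * Real.pi * ∑' n, ‖(d n : ℂ) * u ^ n‖ ^ 2) +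
        l⁻¹ / 2 * (2 * Real.pi * ∑' n, ‖(1 : ℂ) * u ^ n‖ ^ 2) := by
        rw [integral_add (integrableOn_of_continuous_Ioo (by fun_prop) _ _)
          (integrableOn_of_continuous_Ioo (by fun_prop) _ _), integral_const_mul,
          integral_const_mul, integral_norm_sq_tsum_exp hd', integral_norm_sq_tsum_exp hg]
    _ = Real.pi * (l * ∑' n, d n ^ 2 * ‖u‖ ^ (2 * n) + l⁻¹ * (1 - ‖u‖ ^ 2)⁻¹) := by
        have e1 : ∀ n, ‖(d n : ℂ) * u ^ n‖ ^ 2 = d n ^ 2 * ‖u‖ ^ (2 * n) := by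
          intro n; rw [norm_mul, norm_pow, mul_pow, ← pow_mul, mul_comm n 2]; simp
        have e2 : ∀ n, ‖(1 : ℂ) * u ^ n‖ ^ 2 = (‖u‖ ^ 2) ^ n := by
          intro n; rw [one_mul, norm_pow, ← pow_mul, ← pow_mul, mul_comm n 2]
        simp_rw [e1, e2]
        rw [tsum_geometric_of_lt_one (by positivity) (by nlinarith [norm_nonneg u])]
        ring
    _ ≤ _ := by
        have : (1 - ‖u‖ ^ 2)⁻¹ ≤ (1 - ‖u‖)⁻¹ :=
          inv_anti₀ (by linarith) (by nlinarith [norm_nonneg u])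
        gcongr

/-! ### The Bergman kernel as a power series. -/

/-- The Taylor coefficients `1 / (2 ω_{2n+1})` of the Bergman kernel of a radial weight. -/
noncomputable def kernelCoeff (ω : ℝ → ℝ) (n : ℕ) : ℝ := (2 * radialMoment ω (2 * n + 1))⁻¹

/-- The one-variable function whose value at `z̄ ζ` is the Bergman kernel. -/
noncomputable def kernelSeries (ω : ℝ → ℝ) (w : ℂ) : ℂ := ∑' n, (kernelCoeff ω n : ℂ) * w ^ n

/-- The derivative of `kernelSeries`. -/
noncomputable def kernelSeriesDeriv (ω : ℝ → ℝ) (w : ℂ) : ℂ :=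
  ∑' n : ℕ, (((n + 1) * kernelCoeff ω (n + 1) : ℝ) : ℂ) * w ^ n

theorem continuousOn_aestronglyMeasurable_discArea {f : ℂ → ℂ}
    (hf : ContinuousOn f (Metric.ball 0 1)) : AEStronglyMeasurable f discArea := by
  unfold discArea
  exact (hf.aestronglyMeasurable measurableSet_ball).smul_measure _

namespace IsRadialWeight

variable {ω : ℝ → ℝ}

theorem kernelCoeff_pos (hω : IsRadialWeight ω) (n : ℕ) : 0 < kernelCoeff ω n :=
  inv_pos.2 (mul_pos two_pos (hω.moment_pos _))

/-- Since `t < 1` is free, this gives convergence on the unit disc; the constant is kept explicit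
because `t` is later tied to the radius and `ω̂(t)` compared with `ω̂` there. -/
theorem kernelCoeff_le (hω : IsRadialWeight ω) {t : ℝ} (ht0 : 0 < t) (ht1 : t < 1) (n : ℕ) :
    kernelCoeff ω n ≤ (2 * t * radialTail ω t)⁻¹ * (t ^ 2)⁻¹ ^ n := by
  have hT := hω.tail_pos t ⟨ht0.le, ht1⟩
  rw [inv_pow, ← mul_inv]
  refine inv_anti₀ (by positivity) ?_
  have := hω.pow_mul_tail_le_moment ⟨ht0.le, ht1.le⟩ (2 * n + 1)
  calc 2 * t * radialTail ω t * (t ^ 2) ^ n = 2 * (t ^ (2 * n + 1) * radialTail ω t) := by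
        rw [pow_succ t (2 * n), pow_mul]; ring
    _ ≤ _ := by linarith

theorem summable_succ_mul_kernelCoeff (hω : IsRadialWeight ω) {ρ : ℝ} (h0 : 0 ≤ ρ) (h1 : ρ < 1) :
    Summable fun n : ℕ => ((n : ℝ) + 1) * kernelCoeff ω n * ρ ^ n := by
  -- Here `t² - ρ = (1-ρ)²/4 > 0`, so the comparison series has ratio `ρ/t² < 1`.
  set t := (1 + ρ) / 2 with ht
  have ht0 : 0 < t := by positivity
  have ht1 : t < 1 := by rw [ht]; linarith
  have hq : ρ / t ^ 2 < 1 := by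
    rw [div_lt_one (by positivity)]
    nlinarith [mul_pos (sub_pos.2 h1) (sub_pos.2 h1)]
  have hq0 : 0 ≤ ρ / t ^ 2 := by positivity
  have hn : ‖ρ / t ^ 2‖ < 1 := by rwa [Real.norm_of_nonneg hq0]
  have hs : Summable fun n : ℕ => ((n : ℝ) + 1) * (ρ / t ^ 2) ^ n := by
    have := (summable_pow_mul_geometric_of_norm_lt_one 1 hn).add
      (summable_geometric_of_lt_one hq0 hq)
    refine this.congr fun n => ?_
    ring
  refine Summable.of_nonneg_of_le (fun n => ?_) (fun n => ?_)
    (hs.mul_left (2 * t * radialTail ω t)⁻¹)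
  · have := (hω.kernelCoeff_pos n).le; positivity
  · have := hω.kernelCoeff_le ht0 ht1 n
    calc ((n : ℝ) + 1) * kernelCoeff ω n * ρ ^ n
        ≤ ((n : ℝ) + 1) * ((2 * t * radialTail ω t)⁻¹ * (t ^ 2)⁻¹ ^ n) * ρ ^ n := by gcongr
      _ = _ := by rw [div_eq_mul_inv, mul_pow]; ring

theorem summable_kernelCoeff (hω : IsRadialWeight ω) {ρ : ℝ} (h0 : 0 ≤ ρ) (h1 : ρ < 1) :
    Summable fun n : ℕ => kernelCoeff ω n * ρ ^ n := by
  refine Summable.of_nonneg_of_le (fun n => mul_nonneg (hω.kernelCoeff_pos n).le (pow_nonneg h0 n))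
    (fun n => ?_) (hω.summable_succ_mul_kernelCoeff h0 h1)
  have := mul_nonneg (hω.kernelCoeff_pos n).le (pow_nonneg h0 n)
  rw [mul_assoc]
  exact le_mul_of_one_le_left this (by linarith [(Nat.cast_nonneg n : (0 : ℝ) ≤ n)])

theorem summable_kernelCoeff_deriv (hω : IsRadialWeight ω) {ρ : ℝ} (h0 : 0 ≤ ρ) (h1 : ρ < 1) :
    Summable fun n : ℕ => ((n : ℝ) + 1) * kernelCoeff ω (n + 1) * ρ ^ n := by
  rcases h0.eq_or_lt with rfl | h0
  · refine summable_of_ne_finset_zero (s := {0}) fun n hn => ?_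
    simp at hn
    simp [hn]
  · have := ((summable_nat_add_iff 1).2 (hω.summable_succ_mul_kernelCoeff h0.le h1)).mul_right ρ⁻¹
    refine Summable.of_nonneg_of_le (fun n => ?_) (fun n => ?_) this
    · have := (hω.kernelCoeff_pos (n + 1)).le; positivity
    · have h2 := (hω.kernelCoeff_pos (n + 1)).le
      rw [pow_succ, ← mul_assoc, mul_assoc _ ρ, mul_inv_cancel₀ h0.ne', mul_one]
      push_cast
      gcongr
      linarith

theorem hasDerivAt_kernelSeries (hω : IsRadialWeight ω) {w : ℂ} (hw : ‖w‖ < 1) :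
    HasDerivAt (kernelSeries ω) (kernelSeriesDeriv ω w) w := by
  obtain ⟨ρ, hwρ, hρ⟩ := exists_between hw
  have hρ0 : 0 ≤ ρ := (norm_nonneg w).trans hwρ.le
  have hu : Summable fun n : ℕ => (n : ℝ) * kernelCoeff ω n * ρ ^ (n - 1) := by
    rw [← summable_nat_add_iff 1]
    simpa using hω.summable_kernelCoeff_deriv hρ0 hρ
  have hd : ∀ n (y : ℂ), HasDerivAt (fun y => (kernelCoeff ω n : ℂ) * y ^ n)
      ((kernelCoeff ω n : ℂ) * (n * y ^ (n - 1))) y := fun n y =>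
    (hasDerivAt_pow n y).const_mul _
  have h := hasDerivAt_tsum_of_isPreconnected hu Metric.isOpen_ball
    (convex_ball (0 : ℂ) ρ).isPreconnected (fun n y _ => hd n y) (fun n y hy => ?_)
    (y₀ := 0) (by simpa using (norm_nonneg w).trans_lt hwρ) ?_ (y := w) (by simpa using hwρ)
  · convert! h using 1
    rw [tsum_eq_zero_add']
    · simp only [CharP.cast_eq_zero, zero_mul, mul_zero, zero_add, Nat.add_sub_cancel]
      unfold kernelSeriesDeriv
      congr 1; ext n; push_cast; ring
    · refine Summable.of_norm ?_
      refine (hω.summable_kernelCoeff_deriv (norm_nonneg w) hw).congr fun n => ?_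
      have := (hω.kernelCoeff_pos (n + 1)).le
      rw [norm_mul, norm_mul, norm_pow, Complex.norm_of_nonneg this, Complex.norm_natCast,
        Nat.add_sub_cancel]
      push_cast; ring
  · have hy' : ‖y‖ ≤ ρ := by simpa using (mem_ball_zero_iff.1 hy).le
    have := (hω.kernelCoeff_pos n).le
    rw [norm_mul, norm_mul, norm_pow, Complex.norm_of_nonneg this, Complex.norm_natCast,
      mul_left_comm, ← mul_assoc]
    gcongr
  · refine summable_of_ne_finset_zero (s := {0}) fun n hn => ?_
    simp at hn
    simp [hn]

theorem differentiableOn_kernelSeries (hω : IsRadialWeight ω) :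
    DifferentiableOn ℂ (kernelSeries ω) (Metric.ball 0 1) := fun _ hw =>
  (hω.hasDerivAt_kernelSeries (mem_ball_zero_iff.1 hw)).differentiableAt.differentiableWithinAt

theorem continuousOn_kernelSeriesDeriv (hω : IsRadialWeight ω) :
    ContinuousOn (kernelSeriesDeriv ω) (Metric.ball 0 1) :=
  (hω.differentiableOn_kernelSeries.deriv Metric.isOpen_ball).continuousOn.congr fun _ hw =>
    (hω.hasDerivAt_kernelSeries (mem_ball_zero_iff.1 hw)).deriv.symm

theorem norm_kernelSeries_le (hω : IsRadialWeight ω) {ρ : ℝ} (hρ : ρ < 1) {w : ℂ} (hw : ‖w‖ ≤ ρ) :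
    ‖kernelSeries ω w‖ ≤ ∑' n, kernelCoeff ω n * ρ ^ n := by
  refine tsum_of_norm_bounded
    (hω.summable_kernelCoeff ((norm_nonneg w).trans hw) hρ).hasSum fun n => ?_
  have := (hω.kernelCoeff_pos n).le
  rw [norm_mul, norm_pow, Complex.norm_of_nonneg this]
  gcongr

theorem norm_kernelSeriesDeriv_le (hω : IsRadialWeight ω) {ρ : ℝ} (hρ : ρ < 1) {w : ℂ}
    (hw : ‖w‖ ≤ ρ) :
    ‖kernelSeriesDeriv ω w‖ ≤ ∑' n : ℕ, ((n : ℝ) + 1) * kernelCoeff ω (n + 1) * ρ ^ n := by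
  refine tsum_of_norm_bounded
    (hω.summable_kernelCoeff_deriv ((norm_nonneg w).trans hw) hρ).hasSum fun n => ?_
  have := (hω.kernelCoeff_pos (n + 1)).le
  rw [norm_mul, norm_pow, Complex.norm_of_nonneg (by positivity)]
  gcongr

theorem conj_kernelSeries (ω : ℝ → ℝ) (w : ℂ) :
    (starRingEnd ℂ) (kernelSeries ω w) = kernelSeries ω ((starRingEnd ℂ) w) := by
  unfold kernelSeries
  rw [Complex.conj_tsum]
  simp

theorem conj_kernelSeriesDeriv (ω : ℝ → ℝ) (w : ℂ) :
    (starRingEnd ℂ) (kernelSeriesDeriv ω w) = kernelSeriesDeriv ω ((starRingEnd ℂ) w) := by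
  unfold kernelSeriesDeriv
  rw [Complex.conj_tsum]
  simp only [map_mul, map_pow, Complex.conj_ofReal]

theorem norm_mul_conj_le {z ζ : ℂ} (hζ : ζ ∈ Metric.ball (0 : ℂ) 1) :
    ‖z * (starRingEnd ℂ) ζ‖ ≤ ‖z‖ := by
  rw [norm_mul, RCLike.norm_conj]
  exact mul_le_of_le_one_right (norm_nonneg _) (mem_ball_zero_iff.1 hζ).le

theorem continuousOn_comp_mul_conj {f : ℂ → ℂ} (hf : ContinuousOn f (Metric.ball 0 1))
    {z : ℂ} (hz : ‖z‖ < 1) :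
    ContinuousOn (fun ζ => f (z * (starRingEnd ℂ) ζ)) (Metric.ball 0 1) :=
  hf.comp ((continuous_const.mul Complex.continuous_conj).continuousOn) fun _ hζ =>
    mem_ball_zero_iff.2 ((norm_mul_conj_le hζ).trans_lt hz)

theorem integrable_mul_bounded {g h : ℂ → ℂ} (hg : Integrable g discArea)
    (hh : ContinuousOn h (Metric.ball 0 1)) {B : ℝ} (hB : ∀ ζ ∈ Metric.ball (0 : ℂ) 1, ‖h ζ‖ ≤ B) :
    Integrable (fun ζ => g ζ * h ζ) discArea :=
  hg.mul_bdd (c := B) (continuousOn_aestronglyMeasurable_discArea hh)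
    (ae_discArea_mem_ball.mono hB)

/-- Term by term integration against the kernel. -/
theorem hasSum_integral_mul_kernelSeries (hω : IsRadialWeight ω) {g : ℂ → ℂ}
    (hg : Integrable g discArea) {z : ℂ} (hz : ‖z‖ < 1) :
    HasSum (fun n => (kernelCoeff ω n : ℂ) * z ^ n *
        ∫ ζ, g ζ * (starRingEnd ℂ) ζ ^ n ∂discArea)
      (∫ ζ, g ζ * kernelSeries ω (z * (starRingEnd ℂ) ζ) ∂discArea) := by
  have hpow : ∀ n : ℕ, Integrable (fun ζ => g ζ * (starRingEnd ℂ) ζ ^ n) discArea := fun n =>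
    integrable_mul_bounded hg (Complex.continuous_conj.pow n).continuousOn (B := 1) fun ζ hζ => by
      rw [norm_pow, RCLike.norm_conj]
      exact pow_le_one₀ (norm_nonneg _) (mem_ball_zero_iff.1 hζ).le
  have h := hasSum_integral_of_summable_integral_norm (μ := discArea)
    (F := fun n ζ => (kernelCoeff ω n : ℂ) * z ^ n * (g ζ * (starRingEnd ℂ) ζ ^ n))
    (fun n => (hpow n).const_mul _) ?_
  · simp_rw [integral_const_mul] at h
    convert! h using 1
    refine integral_congr_ae (.of_forall fun ζ => ?_)
    simp only [kernelSeries]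
    rw [← tsum_mul_left]
    congr 1; ext n; rw [mul_pow]; ring
  · refine Summable.of_nonneg_of_le (fun n => integral_nonneg fun _ => norm_nonneg _) (fun n => ?_)
      ((hω.summable_kernelCoeff (norm_nonneg z) hz).mul_right (∫ ζ, ‖g ζ‖ ∂discArea))
    rw [← integral_const_mul]
    refine integral_mono_ae ((hpow n).const_mul _).norm (hg.norm.const_mul _) ?_
    filter_upwards [ae_discArea_mem_ball] with ζ hζ
    have := (hω.kernelCoeff_pos n).le
    rw [norm_mul, norm_mul, norm_mul, norm_pow, norm_pow, RCLike.norm_conj,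
      Complex.norm_of_nonneg this]
    have h1 : ‖ζ‖ ^ n ≤ 1 := pow_le_one₀ (norm_nonneg _) (mem_ball_zero_iff.1 hζ).le
    exact mul_le_mul_of_nonneg_left (mul_le_of_le_one_right (norm_nonneg _) h1) (by positivity)

theorem integrable_weight (hω : IsRadialWeight ω) :
    Integrable (fun ζ : ℂ => (ω ‖ζ‖ : ℂ)) discArea :=
  integrable_radial (h := fun r => (ω r : ℂ)) hω.integrableOn_Ioo.ofReal

theorem integrable_weight_real (hω : IsRadialWeight ω) :
    Integrable (fun ζ : ℂ => ω ‖ζ‖) discArea :=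
  integrable_radial hω.integrableOn_Ioo

/-- Integrals of analytic functions against monomials pick out the Taylor coefficients. -/
theorem integral_mul_conj_pow (ω : ℝ → ℝ) {f : ℂ → ℂ} (hf : DifferentiableOn ℂ f (Metric.ball 0 1))
    (n : ℕ) (hi : Integrable (fun ζ => f ζ * (ω ‖ζ‖ : ℂ) * (starRingEnd ℂ) ζ ^ n) discArea) :
    ∫ ζ, f ζ * (ω ‖ζ‖ : ℂ) * (starRingEnd ℂ) ζ ^ n ∂discArea =
      2 * radialMoment ω (2 * n + 1) * ((n.factorial : ℂ)⁻¹ * iteratedDeriv n f 0) := by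
  set a : ℕ → ℂ := fun n => (n.factorial : ℂ)⁻¹ * iteratedDeriv n f 0 with ha
  rw [integral_discArea hi]
  have hinner : ∀ r ∈ Ioo (0 : ℝ) 1, ((r / Real.pi : ℝ) : ℂ) *
      ∫ θ in Ioo (-Real.pi) Real.pi, f (Complex.polarCoord.symm (r, θ)) *
        (ω ‖Complex.polarCoord.symm (r, θ)‖ : ℂ) *
        (starRingEnd ℂ) (Complex.polarCoord.symm (r, θ)) ^ n =
      2 * a n * ((r ^ (2 * n + 1) * ω r : ℝ) : ℂ) := by
    intro r hr
    have hser : ∀ θ : ℝ, HasSum (fun k => a k * r ^ k * Complex.exp (θ * Complex.I) ^ k)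
        (f (Complex.polarCoord.symm (r, θ))) := by
      intro θ
      have hmem : Complex.polarCoord.symm (r, θ) ∈ Metric.ball (0 : ℂ) 1 := by
        rw [mem_ball_zero_iff, Complex.norm_polarCoord_symm, abs_of_pos hr.1]; exact hr.2
      have := Complex.hasSum_taylorSeries_on_ball hf hmem
      convert! this using 1
      ext k
      rw [ha, sub_zero, polarCoord_symm_eq_mul_exp, mul_pow, smul_eq_mul, smul_eq_mul]
      ring
    have hsum : Summable fun k => ‖a k * (r : ℂ) ^ k‖ := by
      have := (hser 0).summable.norm
      simpa using this
    have h2 : ∀ θ : ℝ, f (Complex.polarCoord.symm (r, θ)) *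
        (ω ‖Complex.polarCoord.symm (r, θ)‖ : ℂ) *
        (starRingEnd ℂ) (Complex.polarCoord.symm (r, θ)) ^ n =
        (ω r * r ^ n : ℂ) * ((∑' k, a k * r ^ k * Complex.exp (θ * Complex.I) ^ k) *
          (starRingEnd ℂ) (Complex.exp (θ * Complex.I)) ^ n) := by
      intro θ
      rw [(hser θ).tsum_eq, Complex.norm_polarCoord_symm, abs_of_pos hr.1,
        polarCoord_symm_eq_mul_exp, map_mul, Complex.conj_ofReal, mul_pow]
      ring
    simp_rw [h2]
    rw [integral_const_mul, integral_tsum_exp_mul_conj hsum n]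
    have hpi : (Real.pi : ℂ) ≠ 0 := by exact_mod_cast Real.pi_ne_zero
    push_cast
    field_simp
    ring
  rw [setIntegral_congr_fun measurableSet_Ioo hinner, integral_const_mul, integral_complex_ofReal,
    radialMoment, intervalIntegral.integral_of_le zero_le_one, integral_Ioc_eq_integral_Ioo]
  simp only [ha]
  ring

/-- From `|f| ≤ |f|² + 1` and the integrability of `ω`. -/
theorem memBergmanTwo_integrable (hω : IsRadialWeight ω) {f : ℂ → ℂ} (hf : MemBergmanTwo ω f) :
    Integrable (fun ζ => f ζ * (ω ‖ζ‖ : ℂ)) discArea := by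
  refine Integrable.mono' (hf.2.add hω.integrable_weight_real)
    ((continuousOn_aestronglyMeasurable_discArea hf.1.continuousOn).mul hω.integrable_weight.1) ?_
  filter_upwards [ae_discArea_mem_ball] with ζ hζ
  have h0 := hω.nonneg ‖ζ‖ ⟨norm_nonneg _, mem_ball_zero_iff.1 hζ⟩
  rw [norm_mul, Complex.norm_of_nonneg h0, Pi.add_apply, ← add_one_mul]
  exact mul_le_mul_of_nonneg_right (by nlinarith [sq_nonneg (‖f ζ‖ - 1), norm_nonneg (f ζ)]) h0

theorem memBergmanTwo_of_bounded (hω : IsRadialWeight ω) {f : ℂ → ℂ}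
    (hf : DifferentiableOn ℂ f (Metric.ball 0 1)) {B : ℝ}
    (hB : ∀ ζ ∈ Metric.ball (0 : ℂ) 1, ‖f ζ‖ ≤ B) : MemBergmanTwo ω f := by
  refine ⟨hf, ?_⟩
  refine hω.integrable_weight_real.bdd_mul (c := B ^ 2)
    ((continuousOn_aestronglyMeasurable_discArea hf.continuousOn).norm.pow 2) ?_
  filter_upwards [ae_discArea_mem_ball] with ζ hζ
  rw [norm_pow, norm_norm]
  exact pow_le_pow_left₀ (norm_nonneg _) (hB ζ hζ) 2

theorem norm_conj_mul_lt {z ζ : ℂ} (hz : ‖z‖ < 1) (hζ : ζ ∈ Metric.ball (0 : ℂ) 1) :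
    ‖(starRingEnd ℂ) z * ζ‖ < 1 := by
  rw [norm_mul, RCLike.norm_conj]
  exact (mul_le_of_le_one_right (norm_nonneg _) (mem_ball_zero_iff.1 hζ).le).trans_lt hz

/-- Pairing `f` with `ζⁿ` gives `2 ω_{2n+1}` times its Taylor coefficient, which `aₙ` cancels; what
remains is the Taylor series of `f` at `z`. -/
theorem isReproducingKernelAt_kernelSeries (hω : IsRadialWeight ω) {z : ℂ} (hz : ‖z‖ < 1) :
    IsReproducingKernelAt ω z fun ζ => kernelSeries ω ((starRingEnd ℂ) z * ζ) := by
  refine ⟨hω.memBergmanTwo_of_bounded (hω.differentiableOn_kernelSeries.comp (by fun_prop)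
    fun ζ hζ => mem_ball_zero_iff.2 (norm_conj_mul_lt hz hζ))
    fun ζ hζ => hω.norm_kernelSeries_le hz ?_, fun f hf => ?_⟩
  · rw [norm_mul, RCLike.norm_conj]
    exact mul_le_of_le_one_right (norm_nonneg _) (mem_ball_zero_iff.1 hζ).le
  · have hint := hω.memBergmanTwo_integrable hf
    have h := hω.hasSum_integral_mul_kernelSeries hint hz
    have hpow : ∀ n : ℕ, Integrable (fun ζ => f ζ * (ω ‖ζ‖ : ℂ) * (starRingEnd ℂ) ζ ^ n) discArea :=
      fun n => integrable_mul_bounded hint (Complex.continuous_conj.pow n).continuousOn (B := 1)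
        fun ζ hζ => by
          rw [norm_pow, RCLike.norm_conj]
          exact pow_le_one₀ (norm_nonneg _) (mem_ball_zero_iff.1 hζ).le
    simp_rw [fun n => integral_mul_conj_pow ω hf.1 n (hpow n)] at h
    have h2 := Complex.hasSum_taylorSeries_on_ball hf.1 (mem_ball_zero_iff.2 hz)
    have h3 : (fun n : ℕ => (kernelCoeff ω n : ℂ) * z ^ n * (2 * radialMoment ω (2 * n + 1) *
        ((n.factorial : ℂ)⁻¹ * iteratedDeriv n f 0))) =
        fun n : ℕ => (n.factorial : ℂ)⁻¹ • (z - 0) ^ n • iteratedDeriv n f 0 := by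
      ext n
      have : (radialMoment ω (2 * n + 1) : ℂ) ≠ 0 := by exact_mod_cast (hω.moment_pos _).ne'
      rw [kernelCoeff, sub_zero, smul_eq_mul, smul_eq_mul]
      push_cast
      field_simp
    rw [h3] at h
    rw [h2.unique h]
    refine integral_congr_ae (.of_forall fun ζ => ?_)
    simp only [conj_kernelSeries, map_mul, Complex.conj_conj]
    ring

/-- Reproducing the monomials already determines every Taylor coefficient of `k`. Uniqueness is
needed because `bergmanKernel` is an arbitrary choice among reproducing kernels. -/
theorem eq_kernelSeries_of_isReproducingKernelAt (hω : IsRadialWeight ω) {z : ℂ} {k : ℂ → ℂ}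
    (hk : IsReproducingKernelAt ω z k) {ζ : ℂ} (hζ : ζ ∈ Metric.ball (0 : ℂ) 1) :
    k ζ = kernelSeries ω ((starRingEnd ℂ) z * ζ) := by
  have hint := hω.memBergmanTwo_integrable hk.1
  have hcoef : ∀ n : ℕ, (n.factorial : ℂ)⁻¹ * iteratedDeriv n k 0 =
      kernelCoeff ω n * (starRingEnd ℂ) z ^ n := by
    intro n
    have hbd : ∀ ζ ∈ Metric.ball (0 : ℂ) 1, ‖ζ ^ n‖ ≤ 1 := fun ζ hζ => by
      rw [norm_pow]; exact pow_le_one₀ (norm_nonneg _) (mem_ball_zero_iff.1 hζ).le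
    have h1 := hk.2 (fun ζ => ζ ^ n) (hω.memBergmanTwo_of_bounded (by fun_prop) hbd)
    have h2 := integral_mul_conj_pow ω hk.1.1 n
      (integrable_mul_bounded hint (Complex.continuous_conj.pow n).continuousOn (B := 1)
        fun ζ hζ => by rw [← map_pow, RCLike.norm_conj]; exact hbd ζ hζ)
    have h3 := congrArg (starRingEnd ℂ) h1
    rw [← integral_conj] at h3
    have h4 : ∀ ζ : ℂ, (starRingEnd ℂ) (ζ ^ n * (starRingEnd ℂ) (k ζ) * (ω ‖ζ‖ : ℂ)) =
        k ζ * (ω ‖ζ‖ : ℂ) * (starRingEnd ℂ) ζ ^ n := by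
      intro ζ
      simp only [map_mul, map_pow, Complex.conj_conj, Complex.conj_ofReal]; ring
    simp_rw [h4] at h3
    rw [h2] at h3
    have : (radialMoment ω (2 * n + 1) : ℂ) ≠ 0 := by exact_mod_cast (hω.moment_pos _).ne'
    rw [← map_pow, h3, kernelCoeff]
    push_cast
    field_simp
  have h := Complex.hasSum_taylorSeries_on_ball hk.1.1 hζ
  rw [← h.tsum_eq, kernelSeries]
  congr 1; ext n
  rw [sub_zero, smul_eq_mul, smul_eq_mul, mul_left_comm, hcoef, mul_pow]
  ring

theorem bergmanKernel_eq (hω : IsRadialWeight ω) {z ζ : ℂ} (hz : ‖z‖ < 1)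
    (hζ : ζ ∈ Metric.ball (0 : ℂ) 1) :
    bergmanKernel ω z ζ = kernelSeries ω ((starRingEnd ℂ) z * ζ) :=
  hω.eq_kernelSeries_of_isReproducingKernelAt
    (Classical.epsilon_spec ⟨_, hω.isReproducingKernelAt_kernelSeries hz⟩) hζ

theorem bergmanIntegrand_eq (hω : IsRadialWeight ω) (f : ℂ → ℂ) {z : ℂ} (hz : ‖z‖ < 1) :
    bergmanIntegrand ω f z =ᵐ[discArea]
      fun ζ => f ζ * (ω ‖ζ‖ : ℂ) * kernelSeries ω (z * (starRingEnd ℂ) ζ) := by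
  filter_upwards [ae_discArea_mem_ball] with ζ hζ
  rw [bergmanIntegrand, hω.bergmanKernel_eq hz hζ, conj_kernelSeries, map_mul, Complex.conj_conj]
  ring

theorem bergmanProjection_eq (hω : IsRadialWeight ω) (f : ℂ → ℂ) {z : ℂ} (hz : ‖z‖ < 1) :
    bergmanProjection ω f z =
      ∫ ζ, f ζ * (ω ‖ζ‖ : ℂ) * kernelSeries ω (z * (starRingEnd ℂ) ζ) ∂discArea :=
  integral_congr_ae (hω.bergmanIntegrand_eq f hz)

end IsRadialWeight

/-! ### Necessity: testing the projection on the argument function. -/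

/-- The factor `r` is the polar density and cannot be dropped near `0`; it is absorbed by the
exponent `n + 1` in the integrals against `ω/ν̂`. -/
theorem integrableOn_of_integrable_radial {h : ℝ → ℝ}
    (hh : Integrable (fun ζ : ℂ => h ‖ζ‖) discArea) :
    IntegrableOn (fun r => r * h r) (Ioo 0 1) := by
  have h1 : Integrable (fun p => h ‖Complex.polarCoord.symm p‖) polarMeasure :=
    measurePreserving_polarCoord_symm.integrable_comp_of_integrable hh
  unfold polarMeasure at h1
  have hne : (ae (volume.restrict (Ioo (-Real.pi) Real.pi))).NeBot := by
    rw [ae_neBot, Ne, Measure.restrict_eq_zero, Real.volume_Ioo]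
    simp [Real.pi_pos]
  obtain ⟨θ, hθ⟩ := h1.prod_left_ae.exists
  rw [integrable_withDensity_iff_integrable_smul' (by fun_prop) (by simp)] at hθ
  refine (integrableOn_congr_fun (fun r hr => ?_) measurableSet_Ioo).1 (hθ.const_mul Real.pi)
  simp only [Complex.norm_polarCoord_symm, abs_of_pos hr.1, smul_eq_mul]
  rw [ENNReal.toReal_ofReal (div_nonneg hr.1.le Real.pi_pos.le)]
  field_simp

theorem integral_mul_conj_exp_pow (n : ℕ) :
    ∫ θ in Ioo (-Real.pi) Real.pi, (θ : ℂ) * (starRingEnd ℂ) (Complex.exp (θ * Complex.I)) ^ n =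
      2 * Real.pi * Complex.I * (-1) ^ n / n := by
  have hpi : -Real.pi ≤ Real.pi := by linarith [Real.pi_pos]
  have h : ∀ θ : ℝ, (starRingEnd ℂ) (Complex.exp (θ * Complex.I)) ^ n =
      Complex.exp (-(n * Complex.I) * θ) := by
    intro θ
    rw [← Complex.exp_conj, ← Complex.exp_nat_mul]
    congr 1
    simp
    ring
  simp_rw [h]
  rw [← integral_Ioc_eq_integral_Ioo, ← intervalIntegral.integral_of_le hpi]
  -- For `n = 0` the integral vanishes by oddness, and the right side is `0` by the convention on
  -- division by zero.
  rcases eq_or_ne n 0 with rfl | hn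
  · have := intervalIntegral.integral_ofReal (a := -Real.pi) (b := Real.pi) (μ := volume)
      (f := fun θ => θ)
    simp [this]
  · have hn' : (n : ℂ) ≠ 0 := by exact_mod_cast hn
    set c : ℂ := -(n * Complex.I) with hc
    have hc0 : c ≠ 0 := neg_ne_zero.2 (mul_ne_zero hn' Complex.I_ne_zero)
    have hder : ∀ θ ∈ uIcc (-Real.pi) Real.pi,
        HasDerivAt (fun θ : ℝ => (θ / c - 1 / c ^ 2) * Complex.exp (c * θ))
          ((θ : ℂ) * Complex.exp (c * θ)) θ := by
      intro θ _
      have h1 : HasDerivAt (fun y : ℂ => (y / c - 1 / c ^ 2) * Complex.exp (c * y))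
          (1 / c * Complex.exp (c * θ) +
            ((θ : ℂ) / c - 1 / c ^ 2) * (Complex.exp (c * θ) * (c * 1))) (θ : ℂ) :=
        (((hasDerivAt_id (θ : ℂ)).div_const c).sub_const _).mul
          (((hasDerivAt_id (θ : ℂ)).const_mul c).cexp)
      convert! h1.comp_ofReal using 1
      field_simp
      ring
    rw [intervalIntegral.integral_eq_sub_of_hasDerivAt hder
      ((by fun_prop : Continuous fun θ : ℝ => (θ : ℂ) * Complex.exp (c * θ)).intervalIntegrable _ _)]
    have e1 : Complex.exp (c * (Real.pi : ℝ)) = (-1) ^ n := by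
      rw [hc, show -((n : ℂ) * Complex.I) * (Real.pi : ℝ) = -(n * (Real.pi * Complex.I)) by ring,
        Complex.exp_neg, Complex.exp_nat_mul, Complex.exp_pi_mul_I, ← inv_pow]
      norm_num
    have e2 : Complex.exp (c * ((-Real.pi : ℝ) : ℂ)) = (-1) ^ n := by
      rw [hc, show -((n : ℂ) * Complex.I) * ((-Real.pi : ℝ) : ℂ) = n * (Real.pi * Complex.I) by
        push_cast; ring, Complex.exp_nat_mul, Complex.exp_pi_mul_I]
    rw [e1, e2, hc]
    have hI : (Complex.I : ℂ) ≠ 0 := Complex.I_ne_zero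
    push_cast
    field_simp
    ring_nf
    simp only [show Complex.I ^ 3 = -Complex.I by rw [pow_succ, Complex.I_sq]; ring]
    ring

/-- An almost everywhere bound for a continuous function on the disc holds everywhere. -/
theorem le_of_ae_discArea {g : ℂ → ℝ} (hg : ContinuousOn g (Metric.ball 0 1)) {B : ℝ}
    (h : ∀ᵐ z ∂discArea, g z ≤ B) : ∀ z ∈ Metric.ball (0 : ℂ) 1, g z ≤ B := by
  intro z hz
  by_contra! hlt
  have hopen : IsOpen (Metric.ball (0 : ℂ) 1 ∩ g ⁻¹' Ioi B) :=
    hg.isOpen_inter_preimage Metric.isOpen_ball isOpen_Ioi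
  have hpos := hopen.measure_pos volume ⟨z, hz, hlt⟩
  have h2 : ∀ᵐ z ∂volume.restrict (Metric.ball (0 : ℂ) 1), g z ≤ B := by
    unfold discArea at h
    rwa [Measure.ae_ennreal_smul_measure_eq] at h
    simp [Real.pi_pos]
  rw [ae_restrict_iff' measurableSet_ball] at h2
  refine hpos.ne' (measure_mono_null (fun w hw => ?_) h2)
  simp only [mem_compl_iff, mem_ofPred_eq, Classical.not_imp, not_le]
  exact ⟨hw.1, hw.2⟩

theorem memGrowth_of_le {v : ℝ → ℝ} {f : ℂ → ℂ} (hf : AEStronglyMeasurable f discArea) {B : ℝ}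
    (hB : ∀ ζ ∈ Metric.ball (0 : ℂ) 1, ‖f ζ‖ * v ‖ζ‖ ≤ B) : MemGrowth v f := by
  refine ⟨hf, lt_of_le_of_lt (essSup_le_of_ae_le (ENNReal.ofReal B) ?_) ENNReal.ofReal_lt_top⟩
  filter_upwards [ae_discArea_mem_ball] with ζ hζ
  exact ENNReal.ofReal_le_ofReal (hB ζ hζ)

theorem ae_le_growthNorm {v : ℝ → ℝ} {f : ℂ → ℂ} (hf : growthNorm v f < ⊤) :
    ∀ᵐ ζ ∂discArea, ‖f ζ‖ * v ‖ζ‖ ≤ (growthNorm v f).toReal := by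
  filter_upwards [ENNReal.ae_le_essSup (μ := discArea)
    (fun z : ℂ => ENNReal.ofReal (‖f z‖ * v ‖z‖))] with ζ hζ
  exact (ENNReal.ofReal_le_iff_le_toReal hf.ne).1 hζ

theorem half_le_sum_block (N : ℕ) (hN : 1 ≤ N) :
    (1 / 2 : ℝ) ≤ ∑ n ∈ Finset.Ioc N (2 * N), (1 / n : ℝ) := by
  have h : ∑ _n ∈ Finset.Ioc N (2 * N), (1 / (2 * N : ℕ) : ℝ) ≤
      ∑ n ∈ Finset.Ioc N (2 * N), (1 / n : ℝ) := by
    refine Finset.sum_le_sum fun n hn => ?_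
    rw [Finset.mem_Ioc] at hn
    have : (0 : ℝ) < n := by exact_mod_cast (Nat.zero_le N).trans_lt hn.1
    exact one_div_le_one_div_of_le this (by exact_mod_cast hn.2)
  refine le_trans (le_of_eq ?_) h
  have : (N : ℝ) ≠ 0 := by exact_mod_cast (by omega : N ≠ 0)
  rw [Finset.sum_const, Nat.card_Ioc, show 2 * N - N = N by omega, nsmul_eq_mul]
  push_cast
  field_simp

/-- Each of the `L` dyadic blocks contributes at least `1/2`. This divergence of the harmonic series
produces the factor `L` in the necessity argument. -/
theorem le_sum_dyadic (N L : ℕ) (hN : 1 ≤ N) :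
    (L / 2 : ℝ) ≤ ∑ n ∈ Finset.Ioc N (2 ^ L * N), (1 / n : ℝ) := by
  induction L with
  | zero => simp
  | succ L ih =>
    have h1 : N ≤ 2 ^ L * N := Nat.le_mul_of_pos_left N (by positivity)
    have h2 : 2 ^ (L + 1) * N = 2 * (2 ^ L * N) := by rw [pow_succ]; ring
    rw [h2, ← Finset.sum_Ioc_consecutive _ h1 (by omega : 2 ^ L * N ≤ 2 * (2 ^ L * N))]
    have := half_le_sum_block (2 ^ L * N) (hN.trans h1)
    push_cast at *
    linarith

namespace IsRadialWeight

variable {ω ν : ℝ → ℝ}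

theorem moment_iterate_le {D : ℝ} (hD : 0 ≤ D)
    (h : ∀ j, radialMoment ω (j + 1) ≤ D * radialMoment ω (2 * j + 1)) (k j : ℕ) :
    radialMoment ω (j + 1) ≤ D ^ k * radialMoment ω (2 ^ k * j + 1) := by
  induction k with
  | zero => simp
  | succ k ih =>
    refine ih.trans ?_
    rw [pow_succ D, mul_assoc, pow_succ, mul_assoc, mul_left_comm (2 ^ k) 2 j]
    exact mul_le_mul_of_nonneg_left (h _) (pow_nonneg hD k)

/-- For an upper doubling weight, moments are controlled by tail integrals. -/
theorem exists_moment_le_tail (hω : IsRadialWeight ω) (hD : UpperDoubling ω) :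
    ∃ C : ℝ, 0 < C ∧ ∀ r ∈ Ioo (0 : ℝ) 1, ∀ N : ℕ, 1 ≤ N * (1 - r) →
      radialMoment ω (N + 1) ≤ C * radialTail ω r := by
  obtain ⟨C, hC1, hC⟩ := hω.exists_tail_le hD
  set D := 2 * C
  have hD0 : 0 < D := by positivity
  obtain ⟨m, hm⟩ := pow_unbounded_of_one_lt D (one_lt_two)
  -- With `D < 2^m`, this `k` satisfies `m k + 2 ≤ 2^k`, so that `D^k (1/2)^(2^k - 1) ≤ 1/2`.
  set k := 2 * (2 * m + 2) with hk
  have hk2 : m * k + 2 ≤ 2 ^ k := by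
    have h1 : 2 * m + 2 + 1 ≤ 2 ^ (2 * m + 2) := Nat.lt_two_pow_self
    have h2 : (2 * m + 3) ^ 2 ≤ (2 ^ (2 * m + 2)) ^ 2 := Nat.pow_le_pow_left h1 2
    rw [← pow_mul, mul_comm (2 * m + 2) 2, ← hk] at h2
    refine le_trans ?_ h2
    rw [hk]; nlinarith
  refine ⟨2 * D ^ k, by positivity, fun r hr N hN => ?_⟩
  -- Bernoulli for `1/r`: `(1/r)^N ≥ 1 + N(1/r - 1) ≥ 1 + N(1-r) ≥ 2`.
  have hrN : r ^ N ≤ 1 / 2 := by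
    have h1 := one_add_mul_le_pow (a := r⁻¹ - 1)
      (by have := one_le_inv₀ hr.1 |>.2 hr.2.le; linarith) N
    have h2 : 1 - r ≤ r⁻¹ - 1 := by
      have : r * r⁻¹ = 1 := mul_inv_cancel₀ hr.1.ne'
      have h3 : 1 ≤ r⁻¹ := (one_le_inv₀ hr.1).2 hr.2.le
      nlinarith [hr.1, hr.2, mul_nonneg (sub_nonneg.2 hr.2.le) (sub_nonneg.2 h3)]
    have h3 : (2 : ℝ) ≤ r⁻¹ ^ N := by
      have h4 := mul_le_mul_of_nonneg_left h2 (Nat.cast_nonneg N : (0 : ℝ) ≤ N)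
      rw [add_sub_cancel] at h1
      linarith
    rw [inv_pow] at h3
    have := inv_anti₀ two_pos h3
    rw [inv_inv] at this
    simpa using this
  have hmom := moment_iterate_le hD0.le (hω.moment_le_of_tail_le (by positivity) hC) k N
  have hsplit := hω.moment_le_split ⟨hr.1.le, hr.2.le⟩ (N * (2 ^ k - 1)) (N + 1)
  have hidx : N * (2 ^ k - 1) + (N + 1) = 2 ^ k * N + 1 := by
    obtain ⟨q, hq⟩ : ∃ q, 2 ^ k = q + 1 := ⟨2 ^ k - 1, by omega⟩
    rw [hq, Nat.add_sub_cancel]; ring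
  rw [hidx] at hsplit
  have hp := hω.moment_pos (N + 1)
  have hsmall : D ^ k * r ^ (N * (2 ^ k - 1)) ≤ 1 / 2 := by
    rw [pow_mul r N]
    calc D ^ k * (r ^ N) ^ (2 ^ k - 1) ≤ (2 ^ m) ^ k * (1 / 2) ^ (2 ^ k - 1) := by
          have := pow_nonneg hr.1.le N
          gcongr
      _ ≤ (2 ^ m) ^ k * (1 / 2) ^ (m * k + 1) := by
          refine mul_le_mul_of_nonneg_left ?_ (by positivity)
          exact pow_le_pow_of_le_one (by norm_num) (by norm_num) (by omega)
      _ = 1 / 2 := by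
          rw [← pow_mul, pow_succ, ← mul_assoc, ← mul_pow]; norm_num
  -- Now `ω_{N+1} ≤ D^k ω_{2^k N+1} ≤ (1/2) ω_{N+1} + D^k ω̂(r)`, and the first term is absorbed.
  have h5 := mul_le_mul_of_nonneg_left hsplit (pow_nonneg hD0.le k)
  have h6 := mul_le_mul_of_nonneg_right hsmall hp.le
  nlinarith

theorem tail_continuousOn_norm (hν : IsRadialWeight ν) :
    ContinuousOn (fun ζ : ℂ => radialTail ν ‖ζ‖) (Metric.ball 0 1) :=
  hν.tail_continuousOn.comp continuous_norm.continuousOn fun _ hζ =>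
    ⟨norm_nonneg _, (mem_ball_zero_iff.1 hζ).le⟩

theorem tail_pos_of_mem_ball (hν : IsRadialWeight ν) {ζ : ℂ} (hζ : ζ ∈ Metric.ball (0 : ℂ) 1) :
    0 < radialTail ν ‖ζ‖ := hν.tail_pos _ ⟨norm_nonneg _, mem_ball_zero_iff.1 hζ⟩

theorem continuousOn_inv_tail (hν : IsRadialWeight ν) :
    ContinuousOn (fun ζ : ℂ => ((radialTail ν ‖ζ‖)⁻¹ : ℂ)) (Metric.ball 0 1) := by
  have h := hν.tail_continuousOn_norm.inv₀ fun ζ hζ => (hν.tail_pos_of_mem_ball hζ).ne'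
  have := Complex.continuous_ofReal.comp_continuousOn h
  refine this.congr fun ζ _ => ?_
  simp

/-- The essential supremum ignores null sets, but the projection is evaluated on the negative real
axis; continuity upgrades the bound to every point. -/
theorem bound_of_memGrowthAnalytic (hν : IsRadialWeight ν) {F : ℂ → ℂ}
    (hF : MemGrowthAnalytic (radialTail ν) F) :
    ∃ B : ℝ, ∀ z ∈ Metric.ball (0 : ℂ) 1, ‖F z‖ * radialTail ν ‖z‖ ≤ B :=
  ⟨_, le_of_ae_discArea (hF.2.continuousOn.norm.mul hν.tail_continuousOn_norm)
    (ae_le_growthNorm hF.1.2)⟩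

/-- Boundedness forces `ω / ν̂` to be integrable over the disc. -/
theorem integrable_div_tail_of_bounded (hω : IsRadialWeight ω) (hν : IsRadialWeight ν)
    (hb : BergmanProjectionBounded ω (radialTail ν)) :
    Integrable (fun ζ : ℂ => ω ‖ζ‖ / radialTail ν ‖ζ‖) discArea := by
  obtain ⟨C, hC⟩ := hb
  have hf := memGrowth_of_le (v := radialTail ν)
    (continuousOn_aestronglyMeasurable_discArea hν.continuousOn_inv_tail) (B := 1) fun ζ hζ => by
      rw [norm_inv, Complex.norm_of_nonneg (hν.tail_pos_of_mem_ball hζ).le,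
        inv_mul_cancel₀ (hν.tail_pos_of_mem_ball hζ).ne']
  -- For `f = 1/ν̂` at `z = 0` the kernel is the nonzero constant `a₀`, so the convergent integral
  -- is a multiple of that of `ω/ν̂`.
  have hi := (hC _ hf).1 0 (by simp)
  have hi2 := hi.congr (hω.bergmanIntegrand_eq _ (by simp))
  have hK : kernelSeries ω 0 = kernelCoeff ω 0 := by
    unfold kernelSeries
    rw [tsum_eq_single 0 (fun n hn => by simp [hn])]
    simp
  have h0 := (hω.kernelCoeff_pos 0).ne'
  have hi3 := (hi2.const_mul ((kernelCoeff ω 0 : ℂ)⁻¹)).re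
  refine hi3.congr (.of_forall fun ζ => ?_)
  have h0' : (kernelCoeff ω 0 : ℂ) ≠ 0 := by exact_mod_cast h0
  simp only [zero_mul, hK]
  rw [show (kernelCoeff ω 0 : ℂ)⁻¹ * ((radialTail ν ‖ζ‖ : ℂ)⁻¹ * (ω ‖ζ‖ : ℂ) * kernelCoeff ω 0) =
    ((ω ‖ζ‖ / radialTail ν ‖ζ‖ : ℝ) : ℂ) by push_cast; field_simp]
  exact RCLike.ofReal_re _

/-- The coefficient sum obtained by projecting `arg ζ / ν̂(ζ)`. -/
theorem exists_sum_le_of_bounded (hω : IsRadialWeight ω) (hν : IsRadialWeight ν)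
    (hb : BergmanProjectionBounded ω (radialTail ν)) :
    ∃ B : ℝ, ∀ x ∈ Ico (0 : ℝ) 1, ∀ s : Finset ℕ,
      (∑ n ∈ s, 2 * kernelCoeff ω n * x ^ n *
        (∫ r in Ioo (0 : ℝ) 1, r ^ (n + 1) * (ω r / radialTail ν r)) / n) * radialTail ν x ≤ B := by
  have hint := hω.integrable_div_tail_of_bounded hν hb
  obtain ⟨C, hC⟩ := hb
  set f : ℂ → ℂ := fun ζ => (Complex.arg ζ : ℂ) * (radialTail ν ‖ζ‖ : ℂ)⁻¹ with hfdef
  have hargm : AEStronglyMeasurable (fun ζ : ℂ => (Complex.arg ζ : ℂ)) discArea :=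
    (Complex.measurable_ofReal.comp Complex.measurable_arg).aestronglyMeasurable
  have hargb : ∀ ζ : ℂ, ‖(Complex.arg ζ : ℂ)‖ ≤ Real.pi := fun ζ => by
    rw [Complex.norm_real]; exact Complex.abs_arg_le_pi ζ
  have hf : MemGrowth (radialTail ν) f :=
    memGrowth_of_le (hargm.mul
      (continuousOn_aestronglyMeasurable_discArea hν.continuousOn_inv_tail)) (B := Real.pi)
      fun ζ hζ => by
        rw [norm_mul, norm_inv, Complex.norm_of_nonneg (hν.tail_pos_of_mem_ball hζ).le, mul_assoc,
          inv_mul_cancel₀ (hν.tail_pos_of_mem_ball hζ).ne', mul_one]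
        exact hargb ζ
  obtain ⟨B, hB⟩ := hν.bound_of_memGrowthAnalytic (hC f hf).2.1
  refine ⟨B, fun x hx s => ?_⟩
  set W : ℕ → ℝ := fun n => ∫ r in Ioo (0 : ℝ) 1, r ^ (n + 1) * (ω r / radialTail ν r) with hW
  have hfω : Integrable (fun ζ => f ζ * (ω ‖ζ‖ : ℂ)) discArea := by
    have hint' : Integrable (fun ζ : ℂ => Complex.ofReal (ω ‖ζ‖ / radialTail ν ‖ζ‖)) discArea :=
      hint.ofReal
    refine (hint'.bdd_mul (c := Real.pi) hargm (.of_forall hargb)).congr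
      (.of_forall fun ζ => ?_)
    simp only [hfdef]
    push_cast
    ring
  have hpow : ∀ n : ℕ, Integrable (fun ζ => f ζ * (ω ‖ζ‖ : ℂ) * (starRingEnd ℂ) ζ ^ n) discArea :=
    fun n => integrable_mul_bounded hfω (Complex.continuous_conj.pow n).continuousOn (B := 1)
      fun ζ hζ => by
        rw [norm_pow, RCLike.norm_conj]
        exact pow_le_one₀ (norm_nonneg _) (mem_ball_zero_iff.1 hζ).le
  have hcoef : ∀ n : ℕ, ∫ ζ, f ζ * (ω ‖ζ‖ : ℂ) * (starRingEnd ℂ) ζ ^ n ∂discArea =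
      2 * Complex.I * (-1) ^ n / n * W n := by
    intro n
    rw [integral_discArea (hpow n)]
    have hinner : ∀ r ∈ Ioo (0 : ℝ) 1, ((r / Real.pi : ℝ) : ℂ) *
        ∫ θ in Ioo (-Real.pi) Real.pi, f (Complex.polarCoord.symm (r, θ)) *
          (ω ‖Complex.polarCoord.symm (r, θ)‖ : ℂ) *
          (starRingEnd ℂ) (Complex.polarCoord.symm (r, θ)) ^ n =
        2 * Complex.I * (-1) ^ n / n * ((r ^ (n + 1) * (ω r / radialTail ν r) : ℝ) : ℂ) := by
      intro r hr
      have h2 : ∀ θ ∈ Ioo (-Real.pi) Real.pi, f (Complex.polarCoord.symm (r, θ)) *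
          (ω ‖Complex.polarCoord.symm (r, θ)‖ : ℂ) *
          (starRingEnd ℂ) (Complex.polarCoord.symm (r, θ)) ^ n =
          (r ^ n * (ω r / radialTail ν r) : ℂ) * ((θ : ℂ) *
            (starRingEnd ℂ) (Complex.exp (θ * Complex.I)) ^ n) := by
        intro θ hθ
        have harg : Complex.arg (Complex.polarCoord.symm (r, θ)) = θ := by
          rw [Complex.polarCoord_symm_apply, Complex.ofReal_cos, Complex.ofReal_sin]
          exact Complex.arg_mul_cos_add_sin_mul_I hr.1 (Ioo_subset_Ioc_self hθ)
        simp only [hfdef]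
        rw [harg, Complex.norm_polarCoord_symm, abs_of_pos hr.1,
          polarCoord_symm_eq_mul_exp, map_mul, Complex.conj_ofReal, mul_pow]
        ring
      rw [setIntegral_congr_fun measurableSet_Ioo h2, integral_const_mul,
        integral_mul_conj_exp_pow n]
      have hpi : (Real.pi : ℂ) ≠ 0 := by exact_mod_cast Real.pi_ne_zero
      push_cast
      field_simp
      ring
    rw [setIntegral_congr_fun measurableSet_Ioo hinner, integral_const_mul, integral_complex_ofReal]
  have hx' : ‖(-x : ℂ)‖ = x := by rw [norm_neg, Complex.norm_of_nonneg hx.1]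
  have hsum := hω.hasSum_integral_mul_kernelSeries hfω (z := -x) (by rw [hx']; exact hx.2)
  rw [← hω.bergmanProjection_eq f (by rw [hx']; exact hx.2)] at hsum
  -- Evaluating at `-x` cancels the sign `(-1)^n` of the Fourier coefficients of the angle: every
  -- term is `i` times a nonnegative real, so partial sums are bounded by the modulus of the
  -- projection.
  have hterm : ∀ n : ℕ, (kernelCoeff ω n : ℂ) * (-x) ^ n *
      ∫ ζ, f ζ * (ω ‖ζ‖ : ℂ) * (starRingEnd ℂ) ζ ^ n ∂discArea =
      Complex.I * ((2 * kernelCoeff ω n * x ^ n * W n / n : ℝ) : ℂ) := by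
    intro n
    have h1 : (-1 : ℂ) ^ n * (-1) ^ n = 1 := by rw [← mul_pow]; simp
    rw [hcoef n, neg_pow]
    push_cast
    calc _ = ((-1 : ℂ) ^ n * (-1) ^ n) *
          (Complex.I * (2 * kernelCoeff ω n * x ^ n * W n / n)) := by ring
      _ = _ := by rw [h1, one_mul]
  simp_rw [hterm] at hsum
  have hs2 := hsum.mul_left (-Complex.I)
  have hI : -Complex.I * Complex.I = 1 := by rw [neg_mul, Complex.I_mul_I, neg_neg]
  simp_rw [← mul_assoc, hI, one_mul] at hs2
  have hs3 := Complex.hasSum_re hs2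
  simp only [Complex.ofReal_re] at hs3
  have hnn : ∀ n, 0 ≤ 2 * kernelCoeff ω n * x ^ n * W n / n := by
    intro n
    have h1 := (hω.kernelCoeff_pos n).le
    have h2 := pow_nonneg hx.1 n
    have h3 : 0 ≤ W n := setIntegral_nonneg measurableSet_Ioo fun r hr =>
      mul_nonneg (pow_nonneg hr.1.le _) (div_nonneg (hω.nonneg r ⟨hr.1.le, hr.2⟩)
        (hν.tail_nonneg ⟨hr.1.le, hr.2.le⟩))
    positivity
  have h4 : ∑ n ∈ s, 2 * kernelCoeff ω n * x ^ n * W n / n ≤ ‖bergmanProjection ω f (-x)‖ := by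
    refine (sum_le_hasSum s (fun n _ => hnn n) hs3).trans ((Complex.re_le_norm _).trans ?_)
    rw [norm_mul, norm_neg, Complex.norm_I, one_mul]
  have h5 := hB (-x) (by rw [mem_ball_zero_iff, hx']; exact hx.2)
  rw [hx'] at h5
  exact (mul_le_mul_of_nonneg_right h4 (hν.tail_nonneg ⟨hx.1, hx.2.le⟩)).trans h5

/-- Restrict to `(x,1)`, where `1/ν̂(r) ≥ 1/ν̂(x)`. The resulting `1/ν̂(x)` is what later cancels
`ν` altogether. -/
theorem pow_mul_le_moment_div (hω : IsRadialWeight ω) (hν : IsRadialWeight ν)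
    (hint : Integrable (fun ζ : ℂ => ω ‖ζ‖ / radialTail ν ‖ζ‖) discArea) {x : ℝ}
    (hx : x ∈ Ico (0 : ℝ) 1) (n : ℕ) :
    x ^ (n + 1) * (radialTail ω x / radialTail ν x) ≤
      ∫ r in Ioo (0 : ℝ) 1, r ^ (n + 1) * (ω r / radialTail ν r) := by
  have hi : IntegrableOn (fun r => r ^ (n + 1) * (ω r / radialTail ν r)) (Ioo 0 1) := by
    have := integrableOn_of_integrable_radial (h := fun r => ω r / radialTail ν r) hint
    refine (Integrable.bdd_mul this (c := 1) (f := fun r : ℝ => r ^ n)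
      (by fun_prop : Continuous fun r : ℝ => r ^ n).aestronglyMeasurable ?_).congr
      (.of_forall fun r => ?_)
    · filter_upwards [ae_restrict_mem measurableSet_Ioo] with r hr
      rw [norm_pow, Real.norm_of_nonneg hr.1.le]
      exact pow_le_one₀ hr.1.le hr.2.le
    · simp only; ring
  have hsub : Ioo x 1 ⊆ Ioo (0 : ℝ) 1 := Ioo_subset_Ioo_left hx.1
  have hnn : ∀ r ∈ Ioo (0 : ℝ) 1, 0 ≤ r ^ (n + 1) * (ω r / radialTail ν r) := fun r hr =>
    mul_nonneg (pow_nonneg hr.1.le _) (div_nonneg (hω.nonneg r ⟨hr.1.le, hr.2⟩)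
      (hν.tail_nonneg ⟨hr.1.le, hr.2.le⟩))
  calc x ^ (n + 1) * (radialTail ω x / radialTail ν x)
      = ∫ r in Ioo x 1, x ^ (n + 1) / radialTail ν x * ω r := by
        rw [integral_const_mul, ← integral_Ioc_eq_integral_Ioo,
          ← intervalIntegral.integral_of_le hx.2.le, ← radialTail]
        ring
    _ ≤ ∫ r in Ioo x 1, r ^ (n + 1) * (ω r / radialTail ν r) := by
        refine setIntegral_mono_on ((hω.integrableOn_Ioo.mono_set hsub).const_mul _)
          (hi.mono_set hsub) measurableSet_Ioo fun r hr => ?_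
        have hr0 := hsub hr
        have h1 := hν.tail_pos r ⟨hr0.1.le, hr0.2⟩
        have h2 : radialTail ν r ≤ radialTail ν x :=
          hν.tail_antitone ⟨hx.1, hx.2.le⟩ ⟨hr0.1.le, hr0.2.le⟩ hr.1.le
        have h3 := hω.nonneg r ⟨hr0.1.le, hr0.2⟩
        have h4 : x ^ (n + 1) ≤ r ^ (n + 1) := pow_le_pow_left₀ hx.1 hr.1.le _
        rw [mul_div_assoc', mul_div_right_comm]
        refine mul_le_mul_of_nonneg_right ?_ h3
        exact div_le_div₀ (pow_nonneg hr0.1.le _) h4 h1 h2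
    _ ≤ _ := setIntegral_mono_set hi
        ((ae_restrict_iff' measurableSet_Ioo).2 (.of_forall hnn)) hsub.eventuallyLE

theorem lowerDoubling_of_bounded (hω : IsRadialWeight ω) (hD : UpperDoubling ω)
    (hν : IsRadialWeight ν) (hb : BergmanProjectionBounded ω (radialTail ν)) :
    LowerDoubling ω := by
  have hint := hω.integrable_div_tail_of_bounded hν hb
  obtain ⟨B, hB⟩ := hω.exists_sum_le_of_bounded hν hb
  obtain ⟨C, hC0, hC⟩ := hω.exists_moment_le_tail hD
  have hB0 : 0 ≤ B := by simpa using hB 0 (by simp) ∅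
  obtain ⟨L, hL⟩ := exists_nat_gt (32 * B * C)
  have hL0 : (0 : ℝ) < L := lt_of_le_of_lt (by positivity) hL
  -- The harmonic range has length ratio `2^L`; the extra factor `4` ensures `M(1-x) = N(1-r)/4 ≤
  -- 1/2`, hence `x^M ≥ 1/2` by Bernoulli.
  refine ⟨2 ^ (L + 2), 2, one_lt_pow₀ one_lt_two (by omega), one_lt_two, ?_⟩
  filter_upwards [Ioo_mem_nhdsLT (show (0 : ℝ) < 1 by norm_num)] with r hr
  set x := 1 - (1 - r) / 2 ^ (L + 2) with hxdef
  set N := ⌈1 / (1 - r)⌉₊ with hNdef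
  set M := 2 ^ L * N with hMdef
  have h1r : 0 < 1 - r := sub_pos.2 hr.2
  have hN1 : 1 / (1 - r) ≤ N := Nat.le_ceil _
  have hNr : 1 ≤ N * (1 - r) := by rwa [div_le_iff₀ h1r] at hN1
  have hN2 : (N : ℝ) * (1 - r) ≤ 2 := by
    have := (Nat.ceil_lt_add_one (by positivity : 0 ≤ 1 / (1 - r))).le
    have h2 := mul_le_mul_of_nonneg_right this h1r.le
    rw [add_mul, div_mul_cancel₀ _ h1r.ne'] at h2
    linarith [hr.1]
  have hNpos : 1 ≤ N := Nat.ceil_pos.2 (by positivity)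
  have h2L : (0 : ℝ) < 2 ^ (L + 2) := by positivity
  have h4 : (4 : ℝ) ≤ 2 ^ (L + 2) := by
    rw [pow_add]; nlinarith [one_le_pow₀ (n := L) (one_le_two : (1 : ℝ) ≤ 2)]
  have hx1 : x < 1 := by rw [hxdef]; have := div_pos h1r h2L; linarith
  have hx2 : 1 / 2 ≤ x := by
    have : (1 - r) / 2 ^ (L + 2) ≤ 1 / 4 := div_le_div₀ (by norm_num) (by linarith [hr.1]) (by norm_num) h4
    rw [hxdef]; linarith
  have hx : x ∈ Ico (0 : ℝ) 1 := ⟨by linarith, hx1⟩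
  have hMx : (1 / 2 : ℝ) ≤ x ^ M := by
    have h := one_add_mul_le_pow (a := x - 1) (by linarith) M
    rw [add_sub_cancel] at h
    refine le_trans ?_ h
    have : (M : ℝ) * (x - 1) = -(N * (1 - r) / 4) := by
      rw [hMdef, hxdef, pow_add]; push_cast; field_simp; ring
    rw [this]; linarith
  have hTx := hω.tail_pos x hx
  have hvx := hν.tail_pos x hx
  set q := radialTail ω x / radialTail ν x with hq
  have hq0 : 0 < q := div_pos hTx hvx
  set m := radialMoment ω (2 * N + 1) with hm
  have hm0 : 0 < m := hω.moment_pos _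
  have hterm : ∀ n ∈ Finset.Ioc N M, m⁻¹ * (1 / 8 * q) * (1 / n : ℝ) ≤
      2 * kernelCoeff ω n * x ^ n *
        (∫ r in Ioo (0 : ℝ) 1, r ^ (n + 1) * (ω r / radialTail ν r)) / n := by
    intro n hn
    rw [Finset.mem_Ioc] at hn
    have hxn : (1 / 2 : ℝ) ≤ x ^ n := hMx.trans (pow_le_pow_of_le_one hx.1 hx1.le hn.2)
    have hW : 1 / 4 * q ≤ ∫ r in Ioo (0 : ℝ) 1, r ^ (n + 1) * (ω r / radialTail ν r) := by
      refine le_trans ?_ (hω.pow_mul_le_moment_div hν hint hx n)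
      refine mul_le_mul_of_nonneg_right ?_ hq0.le
      rw [pow_succ]; nlinarith
    have ha : m⁻¹ ≤ 2 * kernelCoeff ω n := by
      rw [kernelCoeff, mul_inv, ← mul_assoc, mul_inv_cancel₀ two_ne_zero, one_mul]
      exact inv_anti₀ (hω.moment_pos _) (hω.moment_antitone (by omega))
    rw [mul_one_div]
    refine div_le_div_of_nonneg_right ?_ (Nat.cast_nonneg n)
    calc m⁻¹ * (1 / 8 * q) = m⁻¹ * (1 / 2) * (1 / 4 * q) := by ring
      _ ≤ _ := by
          have := (hω.kernelCoeff_pos n).le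
          have := pow_nonneg hx.1 n
          gcongr
  have hS := Finset.sum_le_sum hterm
  rw [← Finset.mul_sum] at hS
  have hH := mul_le_mul_of_nonneg_left (le_sum_dyadic N L hNpos)
    (by positivity : 0 ≤ m⁻¹ * (1 / 8 * q))
  have hfin := (mul_le_mul_of_nonneg_right (hH.trans hS) hvx.le).trans (hB x hx _)
  -- Here `ν̂(x)` disappears. With `m ≤ C ω̂(r)` and `L > 32BC` this yields `2 ω̂(x) ≤ ω̂(r)`.
  have hfin2 : radialTail ω x * L ≤ 16 * B * m := by
    have : m⁻¹ * (1 / 8 * q) * (L / 2) * radialTail ν x = radialTail ω x * L / (16 * m) := by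
      rw [hq]; field_simp; ring
    rw [this, div_le_iff₀ (by positivity)] at hfin
    linarith
  have hmC : m ≤ C * radialTail ω r :=
    (hω.moment_antitone (by omega : N + 1 ≤ 2 * N + 1)).trans (hC r hr N hNr)
  have hTr := hω.tail_pos r ⟨hr.1.le, hr.2⟩
  have h6 : 16 * B * m ≤ 16 * B * (C * radialTail ω r) :=
    mul_le_mul_of_nonneg_left hmC (by positivity)
  have h7 : 32 * B * C * radialTail ω r ≤ L * radialTail ω r :=
    mul_le_mul_of_nonneg_right hL.le hTr.le
  have h8 : L * (2 * radialTail ω x) ≤ L * radialTail ω r := by linarith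
  exact le_of_mul_le_mul_left h8 hL0

end IsRadialWeight

/-! ### Circle means of the derivative of the kernel. -/

/-- Each of the `m` terms of `1 + r + ⋯ + r^(m-1) = (1 - r^m)/(1-r)` is at least `r^m`. -/
theorem natCast_mul_one_sub_mul_pow_le {r : ℝ} (h0 : 0 ≤ r) (h1 : r ≤ 1) (m : ℕ) :
    m * (1 - r) * r ^ m ≤ 1 - r ^ m := by
  induction m with
  | zero => simp
  | succ m ih =>
    have hp := pow_nonneg h0 m
    have hp1 : r ^ m ≤ 1 := pow_le_one₀ h0 h1
    have h2 := mul_le_mul_of_nonneg_left ih h0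
    have h3 : r * r ^ m ≤ 1 := mul_le_one₀ h1 hp hp1
    rw [pow_succ']
    push_cast
    nlinarith [mul_nonneg (sub_nonneg.2 h1) (sub_nonneg.2 h3)]

namespace IsRadialWeight

variable {ω ν : ℝ → ℝ}

theorem natCast_mul_moment_sub_le (hω : IsRadialWeight ω) (m : ℕ) :
    m * (radialMoment ω (2 * m + 1) - radialMoment ω (2 * (m + 1) + 1)) ≤
      2 * radialMoment ω (m + 1) := by
  unfold radialMoment
  have hi := hω.moment_intervalIntegrable
  rw [← intervalIntegral.integral_sub (hi _) (hi _), ← intervalIntegral.integral_const_mul,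
    ← intervalIntegral.integral_const_mul]
  refine intervalIntegral.integral_mono_on_of_le_Ioo zero_le_one (((hi _).sub (hi _)).const_mul _)
    ((hi _).const_mul _) fun r hr => ?_
  have h1 := hω.nonneg r ⟨hr.1.le, hr.2⟩
  have h2 := natCast_mul_one_sub_mul_pow_le hr.1.le hr.2.le m
  have hp := pow_nonneg hr.1.le m
  have h3 : m * (1 - r) * r ^ m * (1 + r) ≤ 2 := by
    have h4 : m * (1 - r) * r ^ m ≤ 1 := by linarith
    have h5 : 0 ≤ m * (1 - r) * r ^ m :=
      mul_nonneg (mul_nonneg (Nat.cast_nonneg m) (sub_nonneg.2 hr.2.le)) hp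
    nlinarith [hr.1, hr.2]
  calc (m : ℝ) * (r ^ (2 * m + 1) * ω r - r ^ (2 * (m + 1) + 1) * ω r)
      = (m * (1 - r) * r ^ m * (1 + r)) * (r ^ (m + 1) * ω r) := by ring
    _ ≤ 2 * (r ^ (m + 1) * ω r) :=
        mul_le_mul_of_nonneg_right h3 (mul_nonneg (pow_nonneg hr.1.le _) h1)

theorem kernelCoeff_mono (hω : IsRadialWeight ω) : Monotone (kernelCoeff ω) := fun m n hmn =>
  inv_anti₀ (mul_pos two_pos (hω.moment_pos _))
    (mul_le_mul_of_nonneg_left (hω.moment_antitone (by omega)) two_pos.le)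

/-- Consecutive coefficients differ by `O(aₙ₊₁/n)`. Hence the differences of the coefficients
`(n+1)aₙ₊₁` of `k'` are `O(aₙ₊₁)`, a gain of one power of `n`. -/
theorem natCast_mul_kernelCoeff_sub_le (hω : IsRadialWeight ω) {D : ℝ}
    (h : ∀ j, radialMoment ω (j + 1) ≤ D * radialMoment ω (2 * j + 1)) (m : ℕ) :
    m * (kernelCoeff ω (m + 1) - kernelCoeff ω m) ≤ 2 * D * kernelCoeff ω (m + 1) := by
  have h1 := hω.natCast_mul_moment_sub_le m
  have h2 := h m
  have hp1 := hω.moment_pos (2 * m + 1)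
  have hp2 := hω.moment_pos (2 * (m + 1) + 1)
  unfold kernelCoeff
  set a := radialMoment ω (2 * m + 1)
  set b := radialMoment ω (2 * (m + 1) + 1)
  have e1 : (m : ℝ) * ((2 * b)⁻¹ - (2 * a)⁻¹) = m * (a - b) / (2 * a * b) := by
    field_simp
  have e2 : 2 * D * (2 * b)⁻¹ = 2 * (D * a) / (2 * a * b) := by
    field_simp
  rw [e1, e2]
  exact div_le_div_of_nonneg_right (h1.trans (by linarith)) (by positivity)

/-- The `L¹` means of the derivative of the kernel. -/
theorem exists_integral_norm_kernelSeriesDeriv_le (hω : IsRadialWeight ω) (hD : UpperDoubling ω) :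
    ∃ C : ℝ, 0 < C ∧ ∀ u : ℂ, ‖u‖ < 1 →
      ∫ θ in Ioo (-Real.pi) Real.pi, ‖kernelSeriesDeriv ω (u * Complex.exp (θ * Complex.I))‖ ≤
        C / ((1 - ‖u‖) * radialTail ω ‖u‖) := by
  obtain ⟨C, hC1, hC⟩ := hω.exists_tail_le hD
  have hC0 : 0 < C := by linarith
  set E := 1 + 2 * (2 * C) with hE
  have hE0 : 0 < E := by positivity
  refine ⟨Real.pi * (4 * E ^ 2 * C ^ 4 + 1), by positivity, fun u hu => ?_⟩
  set b : ℕ → ℝ := fun n => (n + 1) * kernelCoeff ω (n + 1) with hb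
  set d : ℕ → ℝ := fun n => Nat.casesOn n (b 0) fun k => b (k + 1) - b k with hd
  set ρ := ‖u‖ with hρ
  have hρ0 : 0 ≤ ρ := norm_nonneg u
  have hT := hω.tail_pos ρ ⟨hρ0, hu⟩
  have hapos := hω.kernelCoeff_pos
  have hbs : Summable fun n => |b n| * ρ ^ n := by
    refine (hω.summable_kernelCoeff_deriv hρ0 hu).congr fun n => ?_
    rw [abs_of_nonneg (mul_nonneg (by positivity) (hapos _).le)]
  -- The choice `l = ω̂(ρ)` balances the two terms, both then being of order `1/((1-ρ) ω̂(ρ))`.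
  have hmain := integral_norm_tsum_le (b := b) (d := d) rfl (fun n => rfl) hu hbs hT
  have hdb : ∀ n, |d n| ≤ E * kernelCoeff ω (n + 1) := by
    intro n
    have h1 := hapos (n + 1)
    cases n with
    | zero =>
      have h0 : d 0 = kernelCoeff ω (0 + 1) := by
        change b 0 = _
        simp [hb]
      rw [h0, abs_of_pos h1]
      exact le_mul_of_one_le_left h1.le (by rw [hE]; linarith)
    | succ k =>
      have h2 := hω.natCast_mul_kernelCoeff_sub_le (hω.moment_le_of_tail_le hC0.le hC) (k + 1)
      have h3 := hω.kernelCoeff_mono (Nat.le_succ (k + 1))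
      have h4 : d (k + 1) = kernelCoeff ω (k + 1 + 1) + ((k + 1 : ℕ) : ℝ) *
          (kernelCoeff ω (k + 1 + 1) - kernelCoeff ω (k + 1)) := by
        simp only [hd, hb]; push_cast; ring
      have h5 : 0 ≤ ((k + 1 : ℕ) : ℝ) * (kernelCoeff ω (k + 1 + 1) - kernelCoeff ω (k + 1)) :=
        mul_nonneg (Nat.cast_nonneg _) (sub_nonneg.2 h3)
      rw [h4, abs_of_nonneg (by linarith), hE]
      linarith
  -- Since `1-t = (1-ρ)/4`, two doublings compare `ω̂(ρ)` with `ω̂(t)`. The midpoint `(1+ρ)/2` would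
  -- leave `1 - ρ/t²` only quadratic in `1-ρ`; this `t` makes it at least `(1-ρ)/2`.
  obtain ⟨t, ht⟩ : ∃ t, t = (3 + ρ) / 4 := ⟨_, rfl⟩
  have ht1 : t < 1 := by rw [ht]; linarith
  have ht0 : 3 / 4 ≤ t := by rw [ht]; linarith
  have htp : 0 < t := by linarith
  have hTt := hω.tail_pos t ⟨htp.le, ht1⟩
  have hTT : radialTail ω ρ ≤ C ^ 2 * radialTail ω t := by
    have h1 := hC ρ ⟨hρ0, hu.le⟩
    have h2 := hC ((1 + ρ) / 2) ⟨by positivity, by linarith⟩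
    have e : (1 + (1 + ρ) / 2) / 2 = t := by rw [ht]; ring
    rw [e] at h2
    have := mul_le_mul_of_nonneg_left h2 hC0.le
    linarith
  have hq : ρ / t ^ 2 ≤ 1 - (1 - ρ) / 2 := by
    rw [div_le_iff₀ (by positivity), ht]
    nlinarith [mul_nonneg (sub_nonneg.2 hu.le) (sub_nonneg.2 hu.le), mul_nonneg hρ0 (sub_nonneg.2 hu.le),
      mul_nonneg hρ0 (mul_nonneg (sub_nonneg.2 hu.le) (sub_nonneg.2 hu.le)), pow_nonneg hρ0 3]
  have hq0 : 0 ≤ ρ / t ^ 2 := by positivity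
  have hterm : ∀ n, d n ^ 2 * ρ ^ (2 * n) ≤
      E ^ 2 * (2 / radialTail ω t ^ 2) * (1 - (1 - ρ) / 2) ^ n := by
    intro n
    have h1 := hω.kernelCoeff_le htp ht1 (n + 1)
    have h2 : |d n| ≤ E * ((2 * t * radialTail ω t)⁻¹ * (t ^ 2)⁻¹ ^ (n + 1)) :=
      (hdb n).trans (mul_le_mul_of_nonneg_left h1 hE0.le)
    have h3 : d n ^ 2 ≤ (E * ((2 * t * radialTail ω t)⁻¹ * (t ^ 2)⁻¹ ^ (n + 1))) ^ 2 := by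
      rw [← sq_abs]; exact pow_le_pow_left₀ (abs_nonneg _) h2 2
    have h4 : ((ρ / t ^ 2) ^ 2) ^ n ≤ (1 - (1 - ρ) / 2) ^ n := by
      refine pow_le_pow_left₀ (by positivity) ?_ n
      nlinarith
    have h5 : (4 * t ^ 6)⁻¹ ≤ 2 := by
      have h6 : (3 / 4 : ℝ) ^ 6 ≤ t ^ 6 := pow_le_pow_left₀ (by norm_num) ht0 6
      rw [inv_le_comm₀ (by positivity) two_pos]
      norm_num at h6 ⊢
      linarith
    calc d n ^ 2 * ρ ^ (2 * n)
        ≤ (E * ((2 * t * radialTail ω t)⁻¹ * (t ^ 2)⁻¹ ^ (n + 1))) ^ 2 * ρ ^ (2 * n) := by gcongr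
      _ = E ^ 2 * ((4 * t ^ 6)⁻¹ / radialTail ω t ^ 2) * ((ρ / t ^ 2) ^ 2) ^ n := by
          have e1 : ((2 * t * radialTail ω t)⁻¹) ^ 2 =
              (t ^ 2)⁻¹ * 4⁻¹ * (radialTail ω t ^ 2)⁻¹ := by
            field_simp
            ring
          have e2 : (4 * t ^ 6)⁻¹ = (t ^ 2)⁻¹ ^ 3 * 4⁻¹ := by
            field_simp
          rw [e2, mul_pow, mul_pow, e1, div_eq_mul_inv, div_eq_mul_inv]
          generalize (t ^ 2)⁻¹ = X
          ring
      _ ≤ _ := by gcongr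
  have hgeo : Summable fun n : ℕ => E ^ 2 * (2 / radialTail ω t ^ 2) * (1 - (1 - ρ) / 2) ^ n :=
    (summable_geometric_of_lt_one (by linarith) (by linarith)).mul_left _
  have hsum : ∑' n, d n ^ 2 * ρ ^ (2 * n) ≤
      E ^ 2 * (2 / radialTail ω t ^ 2) * (2 / (1 - ρ)) := by
    refine ((Summable.of_nonneg_of_le (fun n => by positivity) hterm hgeo).tsum_le_tsum hterm
      hgeo).trans (le_of_eq ?_)
    rw [tsum_mul_left, tsum_geometric_of_lt_one (by linarith) (by linarith), sub_sub_cancel, inv_div]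
  have hsq : (2 : ℝ) / radialTail ω t ^ 2 ≤ 2 * C ^ 4 / radialTail ω ρ ^ 2 := by
    rw [div_le_div_iff₀ (by positivity) (by positivity)]
    have := pow_le_pow_left₀ hT.le hTT 2
    nlinarith
  have hρ1 : 0 < 1 - ρ := sub_pos.2 hu
  refine (le_of_eq ?_).trans (hmain.trans ?_)
  · rfl
  · calc Real.pi * (radialTail ω ρ * ∑' n, d n ^ 2 * ρ ^ (2 * n) + (radialTail ω ρ)⁻¹ * (1 - ρ)⁻¹)
        ≤ Real.pi * (radialTail ω ρ * (E ^ 2 * (2 * C ^ 4 / radialTail ω ρ ^ 2) * (2 / (1 - ρ))) +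
          (radialTail ω ρ)⁻¹ * (1 - ρ)⁻¹) := by
          have := hsum.trans (mul_le_mul_of_nonneg_right (mul_le_mul_of_nonneg_left hsq
            (by positivity)) (by positivity))
          gcongr
      _ = _ := by
          field_simp
          ring

end IsRadialWeight

/-! ### The weight with tail `√ω̂` and the derivative of the projection. -/

/-- The weight `ω / (2 √ω̂)`, whose tail integral is `√ω̂`. -/
noncomputable def sqrtTailWeight (ω : ℝ → ℝ) (r : ℝ) : ℝ := ω r * (2 * √(radialTail ω r))⁻¹

namespace IsRadialWeight

variable {ω ν : ℝ → ℝ}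

theorem tail_pos_of_mem_Icc (hω : IsRadialWeight ω) {a b : ℝ} (ha : 0 ≤ a) (hab : a ≤ b)
    (hb : b < 1) {y : ℝ} (hy : y ∈ Icc (radialTail ω b) (radialTail ω a)) : 0 < y :=
  (hω.tail_pos b ⟨ha.trans hab, hb⟩).trans_le hy.1

theorem intervalIntegrable_mul_comp_tail (hω : IsRadialWeight ω) {a b : ℝ} (ha : 0 ≤ a)
    (hab : a ≤ b) (hb : b < 1) {ψ : ℝ → ℝ}
    (hψ : ContinuousOn ψ (Icc (radialTail ω b) (radialTail ω a))) :
    IntervalIntegrable (fun r => ω r * ψ (radialTail ω r)) volume a b := by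
  refine (hω.intervalIntegrable_sub ⟨ha, (hab.trans_lt hb).le⟩
    ⟨ha.trans hab, hb.le⟩).mul_continuousOn ?_
  rw [uIcc_of_le hab]
  refine hψ.comp (hω.tail_continuousOn.mono (Icc_subset_Icc ha hb.le)) fun r hr => ?_
  exact ⟨hω.tail_antitone ⟨ha.trans hr.1, hr.2.trans hb.le⟩ ⟨ha.trans hab, hb.le⟩ hr.2,
    hω.tail_antitone ⟨ha, hab.trans hb.le⟩ ⟨ha.trans hr.1, hr.2.trans hb.le⟩ hr.1⟩

theorem continuousOn_inv_two_sqrt {s : Set ℝ} (hs : ∀ y ∈ s, 0 < y) :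
    ContinuousOn (fun y : ℝ => (2 * √y)⁻¹) s :=
  (by fun_prop : Continuous fun y : ℝ => 2 * √y).continuousOn.inv₀ fun y hy =>
    (mul_pos two_pos (Real.sqrt_pos.2 (hs y hy))).ne'

theorem integral_sqrtTailWeight (hω : IsRadialWeight ω) {a b : ℝ} (ha : 0 ≤ a)
    (hab : a ≤ b) (hb : b < 1) :
    ∫ r in a..b, sqrtTailWeight ω r = √(radialTail ω a) - √(radialTail ω b) := by
  refine hω.integral_mul_comp_tail ha hab hb.le (ψ := Real.sqrt) (ψ' := fun y => (2 * √y)⁻¹)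
    (fun y hy => ?_) (continuousOn_inv_two_sqrt fun y hy => hω.tail_pos_of_mem_Icc ha hab hb hy)
  have := Real.hasDerivAt_sqrt (hω.tail_pos_of_mem_Icc ha hab hb hy).ne'
  rwa [one_div] at this

theorem sqrtTailWeight_nonneg (hω : IsRadialWeight ω) {r : ℝ} (hr : r ∈ Ico (0 : ℝ) 1) :
    0 ≤ sqrtTailWeight ω r := mul_nonneg (hω.nonneg r hr) (by positivity)

theorem isRadialWeight_sqrtTailWeight (hω : IsRadialWeight ω) :
    IsRadialWeight (sqrtTailWeight ω) := by
  have hint : IntegrableOn (sqrtTailWeight ω) (Ioc 0 1) := by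
    have hb1 : ∀ n : ℕ, 1 - 1 / ((n : ℝ) + 1) < 1 := fun n => by
      have : (0 : ℝ) < 1 / ((n : ℝ) + 1) := by positivity
      linarith
    have hb0 : ∀ n : ℕ, 0 ≤ 1 - 1 / ((n : ℝ) + 1) := fun n => by
      rw [sub_nonneg, div_le_one (by positivity)]
      linarith [(Nat.cast_nonneg n : (0 : ℝ) ≤ n)]
    -- `1/√ω̂` blows up at `1`, so integrability comes from the uniform bound `√ω̂(0) - √ω̂(b) ≤
    -- √ω̂(0)` on `[0,b]`, `b → 1`.
    refine integrableOn_Ioc_of_intervalIntegral_norm_bounded_right (l := atTop) (I := √(radialTail ω 0))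
      (b := fun n : ℕ => 1 - 1 / ((n : ℝ) + 1)) (fun n => ?_) ?_ (.of_forall fun n => ?_)
    · rw [← intervalIntegrable_iff_integrableOn_Ioc_of_le (hb0 n)]
      exact hω.intervalIntegrable_mul_comp_tail le_rfl (hb0 n) (hb1 n)
        (continuousOn_inv_two_sqrt fun y hy => hω.tail_pos_of_mem_Icc le_rfl (hb0 n) (hb1 n) hy)
    · simpa using (tendsto_one_div_add_atTop_nhds_zero_nat (𝕜 := ℝ)).const_sub 1
    · have : ∫ x in Ioc 0 (1 - 1 / ((n : ℝ) + 1)), ‖sqrtTailWeight ω x‖ =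
          ∫ x in (0 : ℝ)..(1 - 1 / ((n : ℝ) + 1)), sqrtTailWeight ω x := by
        rw [intervalIntegral.integral_of_le (hb0 n)]
        exact setIntegral_congr_fun measurableSet_Ioc fun x hx => Real.norm_of_nonneg
          (hω.sqrtTailWeight_nonneg ⟨hx.1.le, hx.2.trans_lt (hb1 n)⟩)
      rw [this, hω.integral_sqrtTailWeight le_rfl (hb0 n) (hb1 n)]
      linarith [Real.sqrt_nonneg (radialTail ω (1 - 1 / ((n : ℝ) + 1)))]
  have hii : IntervalIntegrable (sqrtTailWeight ω) volume 0 1 := by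
    rwa [intervalIntegrable_iff_integrableOn_Ioc_of_le zero_le_one]
  refine ⟨fun r hr => hω.sqrtTailWeight_nonneg hr, ?_, fun r hr => ?_⟩
  · rwa [intervalIntegrable_iff_integrableOn_Ico_of_le zero_le_one] at hii
  · have hT0 := Real.sqrt_pos.2 (hω.tail_pos 0 (by simp))
    have hr' : r ∈ Icc (0 : ℝ) 1 := ⟨hr.1, hr.2.le⟩
    have h1 : (2 * √(radialTail ω 0))⁻¹ * radialTail ω r ≤ radialTail (sqrtTailWeight ω) r := by
      unfold radialTail
      rw [← intervalIntegral.integral_const_mul]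
      refine intervalIntegral.integral_mono_on_of_le_Ioo hr.2.le
        ((hω.intervalIntegrable_sub hr' (by simp)).const_mul _)
        (hii.mono_set (by
          rw [uIcc_of_le (zero_le_one : (0 : ℝ) ≤ 1)]; exact uIcc_subset_Icc hr' (by simp)))
        fun x hx => ?_
      have hx' : x ∈ Ico (0 : ℝ) 1 := ⟨hr.1.trans hx.1.le, hx.2⟩
      have hTx := Real.sqrt_pos.2 (hω.tail_pos x hx')
      rw [mul_comm]
      refine mul_le_mul_of_nonneg_left (inv_anti₀ (by positivity) ?_) (hω.nonneg x hx')
      have := Real.sqrt_le_sqrt (hω.tail_antitone (by simp) ⟨hx'.1, hx'.2.le⟩ hx'.1)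
      change 2 * √(radialTail ω x) ≤ 2 * √(radialTail ω 0)
      linarith
    exact (mul_pos (by positivity) (hω.tail_pos r hr)).trans_le h1

/-- The square root is not differentiable at `ω̂(1) = 0`, so the chain rule is used on `[r,b]` and
`b` tends to `1`. -/
theorem tail_sqrtTailWeight (hω : IsRadialWeight ω) {r : ℝ} (hr : r ∈ Icc (0 : ℝ) 1) :
    radialTail (sqrtTailWeight ω) r = √(radialTail ω r) := by
  rcases eq_or_lt_of_le hr.2 with rfl | hr1
  · simp [tail_one]
  have hν := hω.isRadialWeight_sqrtTailWeight
  have hcont : ContinuousWithinAt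
      (fun b => radialTail (sqrtTailWeight ω) b - √(radialTail ω b)) (Icc 0 1) 1 :=
    (hν.tail_continuousOn 1 (by simp)).sub
      (Real.continuous_sqrt.continuousAt.comp_continuousWithinAt (hω.tail_continuousOn 1 (by simp)))
  have h1 := (hcont.mono (s := Ioo r 1) (Ioo_subset_Icc_self.trans
    (Icc_subset_Icc_left hr.1))).tendsto
  have h2 : Tendsto (fun b => radialTail (sqrtTailWeight ω) b - √(radialTail ω b)) (𝓝[Ioo r 1] 1)
      (𝓝 (radialTail (sqrtTailWeight ω) r - √(radialTail ω r))) := by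
    refine tendsto_const_nhds.congr' ?_
    filter_upwards [self_mem_nhdsWithin] with b hb
    have e1 := hν.tail_sub hr ⟨hr.1.trans hb.1.le, hb.2.le⟩
    rw [hω.integral_sqrtTailWeight hr.1 hb.1.le hb.2] at e1
    linarith
  have : (𝓝[Ioo r 1] (1 : ℝ)).NeBot := by
    rw [nhdsWithin_Ioo_eq_nhdsLT hr1]; infer_instance
  have := tendsto_nhds_unique h1 h2
  simp only [tail_one, Real.sqrt_zero, sub_zero] at this
  linarith

/-- The weighted integral controlling the derivative of the projection. -/
theorem integral_sqrtTailWeight_div_le (hω : IsRadialWeight ω) {x : ℝ} (hx : x ∈ Ico (0 : ℝ) 1) :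
    ∫ r in (0 : ℝ)..1, sqrtTailWeight ω r / radialTail ω (x * r) ≤ 2 / √(radialTail ω x) := by
  have hν := hω.isRadialWeight_sqrtTailWeight
  have hx' : x ∈ Icc (0 : ℝ) 1 := ⟨hx.1, hx.2.le⟩
  have hTx := hω.tail_pos x hx
  have hs := Real.sqrt_pos.2 hTx
  have hcont : ContinuousOn (fun r => (radialTail ω (x * r))⁻¹) (Icc 0 1) := by
    refine ContinuousOn.inv₀ (hω.tail_continuousOn.comp (by fun_prop) fun r hr =>
      ⟨mul_nonneg hx.1 hr.1, mul_le_one₀ hx.2.le hr.1 hr.2⟩) fun r hr => ?_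
    exact (hω.tail_pos _ ⟨mul_nonneg hx.1 hr.1,
      (mul_le_of_le_one_right hx.1 hr.2).trans_lt hx.2⟩).ne'
  have hi : ∀ a ∈ Icc (0 : ℝ) 1, ∀ b ∈ Icc (0 : ℝ) 1, IntervalIntegrable
      (fun r => sqrtTailWeight ω r / radialTail ω (x * r)) volume a b := fun a ha b hb =>
    (hν.intervalIntegrable_sub ha hb).mul_continuousOn (hcont.mono (uIcc_subset_Icc ha hb))
  have z0 : (0 : ℝ) ∈ Icc (0 : ℝ) 1 := by simp
  have z1 : (1 : ℝ) ∈ Icc (0 : ℝ) 1 := by simp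
  rw [← intervalIntegral.integral_add_adjacent_intervals (hi 0 z0 x hx') (hi x hx' 1 z1)]
  -- Beyond `x`, `ω̂(xr) ≥ ω̂(x)`, leaving `√ω̂(x)/ω̂(x)`.
  have h1 : ∫ r in x..1, sqrtTailWeight ω r / radialTail ω (x * r) ≤ 1 / √(radialTail ω x) := by
    calc _ ≤ ∫ r in x..1, sqrtTailWeight ω r * (radialTail ω x)⁻¹ := by
          refine intervalIntegral.integral_mono_on_of_le_Ioo hx.2.le (hi x hx' 1 z1)
            ((hν.intervalIntegrable_sub hx' z1).mul_const _) fun r hr => ?_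
          have hr0 := hx.1.trans hr.1.le
          refine mul_le_mul_of_nonneg_left (inv_anti₀ hTx ?_) (hν.nonneg r ⟨hr0, hr.2⟩)
          have : x * r ≤ x := mul_le_of_le_one_right hx.1 hr.2.le
          exact hω.tail_antitone ⟨mul_nonneg hx.1 hr0, this.trans hx.2.le⟩ hx' this
      _ = 1 / √(radialTail ω x) := by
          rw [intervalIntegral.integral_mul_const, ← radialTail, hω.tail_sqrtTailWeight hx']
          rw [← div_eq_mul_inv, Real.sqrt_div_self']
  -- Below `x`, `ω̂(xr) ≥ ω̂(r)`, and `ω/(2 ω̂^{3/2})` is the derivative of `ω̂^{-1/2}`.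
  have h2 : ∫ r in (0 : ℝ)..x, sqrtTailWeight ω r / radialTail ω (x * r) ≤
      1 / √(radialTail ω x) := by
    have hpos : ∀ y ∈ Icc (radialTail ω x) (radialTail ω 0), 0 < y := fun y hy =>
      hω.tail_pos_of_mem_Icc le_rfl hx.1 hx.2 hy
    have hψc : ContinuousOn (fun y : ℝ => (2 * √y)⁻¹ * y⁻¹)
        (Icc (radialTail ω x) (radialTail ω 0)) :=
      (continuousOn_inv_two_sqrt hpos).mul (continuousOn_id.inv₀ fun y hy => (hpos y hy).ne')
    calc _ ≤ ∫ r in (0 : ℝ)..x, ω r * ((2 * √(radialTail ω r))⁻¹ * (radialTail ω r)⁻¹) := by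
          refine intervalIntegral.integral_mono_on_of_le_Ioo hx.1 (hi 0 z0 x hx')
            (hω.intervalIntegrable_mul_comp_tail le_rfl hx.1 hx.2 hψc) fun r hr => ?_
          have hr1 : r ∈ Ico (0 : ℝ) 1 := ⟨hr.1.le, hr.2.trans hx.2⟩
          rw [sqrtTailWeight, div_eq_mul_inv, ← mul_assoc]
          refine mul_le_mul_of_nonneg_left (inv_anti₀ (hω.tail_pos r hr1) ?_)
            (hω.sqrtTailWeight_nonneg hr1)
          have : x * r ≤ r := mul_le_of_le_one_left hr.1.le hx.2.le
          exact hω.tail_antitone ⟨mul_nonneg hx.1 hr.1.le, this.trans hr1.2.le⟩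
            ⟨hr1.1, hr1.2.le⟩ this
      _ = -(√(radialTail ω 0))⁻¹ - -(√(radialTail ω x))⁻¹ := by
          refine hω.integral_mul_comp_tail le_rfl hx.1 hx.2.le (ψ := fun y => -(√y)⁻¹)
            (fun y hy => ?_) hψc
          have hy0 := hpos y hy
          have hsy := Real.sqrt_pos.2 hy0
          have := ((Real.hasDerivAt_sqrt hy0.ne').inv hsy.ne').neg
          convert! this using 1
          rw [Real.sq_sqrt hy0.le]
          field_simp
      _ ≤ _ := by
          have : 0 ≤ (√(radialTail ω 0))⁻¹ := by positivity
          rw [one_div]; linarith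
  calc _ ≤ 1 / √(radialTail ω x) + 1 / √(radialTail ω x) := add_le_add h2 h1
    _ = _ := by ring

/-- The derivative of the projection. -/
theorem hasDerivAt_integral_kernelSeries (hω : IsRadialWeight ω) {g : ℂ → ℂ}
    (hg : Integrable g discArea) {z : ℂ} (hz : ‖z‖ < 1) :
    HasDerivAt (fun z => ∫ ζ, g ζ * kernelSeries ω (z * (starRingEnd ℂ) ζ) ∂discArea)
      (∫ ζ, g ζ * ((starRingEnd ℂ) ζ * kernelSeriesDeriv ω (z * (starRingEnd ℂ) ζ)) ∂discArea)
      z := by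
  obtain ⟨ρ, hzρ, hρ⟩ := exists_between hz
  have hint : ∀ w : ℂ, ‖w‖ < 1 →
      Integrable (fun ζ => g ζ * kernelSeries ω (w * (starRingEnd ℂ) ζ)) discArea := fun w hw =>
    integrable_mul_bounded hg
      (continuousOn_comp_mul_conj hω.differentiableOn_kernelSeries.continuousOn hw)
      fun ζ hζ => hω.norm_kernelSeries_le hw (norm_mul_conj_le hζ)
  refine (hasDerivAt_integral_of_dominated_loc_of_deriv_le (s := Metric.ball 0 ρ)
    (F := fun z ζ => g ζ * kernelSeries ω (z * (starRingEnd ℂ) ζ))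
    (F' := fun z ζ => g ζ * ((starRingEnd ℂ) ζ * kernelSeriesDeriv ω (z * (starRingEnd ℂ) ζ)))
    (bound := fun ζ => ‖g ζ‖ * ∑' n : ℕ, ((n : ℝ) + 1) * kernelCoeff ω (n + 1) * ρ ^ n)
    (Metric.isOpen_ball.mem_nhds (mem_ball_zero_iff.2 hzρ)) ?_ (hint z hz) ?_ ?_
    (hg.norm.mul_const _) ?_).2
  · filter_upwards [Metric.isOpen_ball.mem_nhds (mem_ball_zero_iff.2 hz)] with w hw
    exact (hint w (mem_ball_zero_iff.1 hw)).1
  · exact hg.1.mul (continuousOn_aestronglyMeasurable_discArea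
      (Complex.continuous_conj.continuousOn.mul
        (continuousOn_comp_mul_conj hω.continuousOn_kernelSeriesDeriv hz)))
  · filter_upwards [ae_discArea_mem_ball] with ζ hζ w hw
    rw [norm_mul, norm_mul, RCLike.norm_conj]
    refine mul_le_mul_of_nonneg_left ?_ (norm_nonneg _)
    exact (mul_le_of_le_one_left (norm_nonneg _) (mem_ball_zero_iff.1 hζ).le).trans
      (hω.norm_kernelSeriesDeriv_le hρ ((norm_mul_conj_le hζ).trans (mem_ball_zero_iff.1 hw).le))
  · filter_upwards [ae_discArea_mem_ball] with ζ hζ w hw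
    have h1 := hω.hasDerivAt_kernelSeries
      ((norm_mul_conj_le hζ).trans_lt ((mem_ball_zero_iff.1 hw).trans hρ))
    have h2 := (h1.comp w ((hasDerivAt_id w).mul_const ((starRingEnd ℂ) ζ))).const_mul (g ζ)
    convert! h2 using 1
    ring

/-- The derivative of the projection of a function of moderate growth. -/
theorem exists_norm_deriv_le (hω : IsRadialWeight ω) (hD : UpperDoubling ω) :
    ∃ C : ℝ, 0 < C ∧ ∀ (g : ℂ → ℂ) (M : ℝ), 0 ≤ M → Integrable g discArea →
      (∀ᵐ ζ ∂discArea, ‖g ζ‖ ≤ M * sqrtTailWeight ω ‖ζ‖) → ∀ z : ℂ, ‖z‖ < 1 →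
      ‖∫ ζ, g ζ * ((starRingEnd ℂ) ζ * kernelSeriesDeriv ω (z * (starRingEnd ℂ) ζ)) ∂discArea‖ ≤
        C * M / ((1 - ‖z‖) * √(radialTail ω ‖z‖)) := by
  obtain ⟨C, hC0, hC⟩ := hω.exists_integral_norm_kernelSeriesDeriv_le hD
  refine ⟨C, hC0, fun g M hM hg hgM z hz => ?_⟩
  have hν := hω.isRadialWeight_sqrtTailWeight
  set x := ‖z‖ with hx
  have hx0 : 0 ≤ x := norm_nonneg z
  have hT := hω.tail_pos x ⟨hx0, hz⟩
  have hs := Real.sqrt_pos.2 hT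
  have hz1 : 0 < 1 - x := sub_pos.2 hz
  -- The coefficients are real, so conjugating the argument keeps the modulus and puts it in the
  -- form `u e^{iθ}` of the circle means.
  have hnorm : ∀ ζ, ‖kernelSeriesDeriv ω (z * (starRingEnd ℂ) ζ)‖ =
      ‖kernelSeriesDeriv ω ((starRingEnd ℂ) z * ζ)‖ := by
    intro ζ
    rw [← RCLike.norm_conj, conj_kernelSeriesDeriv, map_mul, Complex.conj_conj]
  have hint : Integrable (fun ζ => sqrtTailWeight ω ‖ζ‖ *
      ‖kernelSeriesDeriv ω ((starRingEnd ℂ) z * ζ)‖) discArea := by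
    refine hν.integrable_weight_real.mul_bdd
      (c := ∑' n : ℕ, ((n : ℝ) + 1) * kernelCoeff ω (n + 1) * x ^ n)
      (continuousOn_aestronglyMeasurable_discArea (hω.continuousOn_kernelSeriesDeriv.comp
        (by fun_prop) fun ζ hζ => mem_ball_zero_iff.2 (norm_conj_mul_lt hz hζ))).norm ?_
    filter_upwards [ae_discArea_mem_ball] with ζ hζ
    rw [norm_norm, ← hnorm]
    exact hω.norm_kernelSeriesDeriv_le hz (norm_mul_conj_le hζ)
  have hstep : ∀ r ∈ Ioo (0 : ℝ) 1, (r / Real.pi) • ∫ θ in Ioo (-Real.pi) Real.pi,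
      sqrtTailWeight ω ‖Complex.polarCoord.symm (r, θ)‖ *
        ‖kernelSeriesDeriv ω ((starRingEnd ℂ) z * Complex.polarCoord.symm (r, θ))‖ ≤
      C / (2 * (1 - x)) * (sqrtTailWeight ω r / radialTail ω (x * r)) := by
    intro r hr
    have hν0 := hν.nonneg r ⟨hr.1.le, hr.2⟩
    have hxr : x * r ≤ x := mul_le_of_le_one_right hx0 hr.2.le
    have hTr := hω.tail_pos (x * r) ⟨mul_nonneg hx0 hr.1.le, hxr.trans_lt hz⟩
    have hu : ‖(starRingEnd ℂ) z * (r : ℂ)‖ = x * r := by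
      rw [norm_mul, RCLike.norm_conj, Complex.norm_of_nonneg hr.1.le]
    have h1 := hC ((starRingEnd ℂ) z * (r : ℂ)) (by rw [hu]; exact hxr.trans_lt hz)
    rw [hu] at h1
    simp only [Complex.norm_polarCoord_symm, abs_of_pos hr.1]
    simp only [polarCoord_symm_eq_mul_exp, ← mul_assoc]
    rw [integral_const_mul, smul_eq_mul]
    have h2 : r / Real.pi ≤ 1 / 2 := by
      rw [div_le_div_iff₀ Real.pi_pos two_pos]
      linarith [hr.2, Real.two_le_pi]
    have h3 : C / ((1 - x * r) * radialTail ω (x * r)) ≤ C / ((1 - x) * radialTail ω (x * r)) :=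
      div_le_div_of_nonneg_left hC0.le (by positivity)
        (mul_le_mul_of_nonneg_right (by linarith) hTr.le)
    calc r / Real.pi * (sqrtTailWeight ω r * _)
        ≤ 1 / 2 * (sqrtTailWeight ω r * (C / ((1 - x) * radialTail ω (x * r)))) := by
          have := h1.trans h3
          gcongr
      _ = _ := by field_simp
  have hcont : ContinuousOn (fun r => (radialTail ω (x * r))⁻¹) (Icc 0 1) := by
    refine ContinuousOn.inv₀ (hω.tail_continuousOn.comp (by fun_prop) fun r hr =>
      ⟨mul_nonneg hx0 hr.1, mul_le_one₀ hz.le hr.1 hr.2⟩) fun r hr => ?_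
    exact (hω.tail_pos _ ⟨mul_nonneg hx0 hr.1,
      (mul_le_of_le_one_right hx0 hr.2).trans_lt hz⟩).ne'
  have hrint : IntegrableOn (fun r => sqrtTailWeight ω r / radialTail ω (x * r)) (Ioo 0 1) := by
    rw [← intervalIntegrable_iff_integrableOn_Ioo_of_le zero_le_one]
    refine hν.intervalIntegrable.mul_continuousOn ?_
    rwa [uIcc_of_le zero_le_one]
  calc _ ≤ ∫ ζ, M * (sqrtTailWeight ω ‖ζ‖ *
        ‖kernelSeriesDeriv ω ((starRingEnd ℂ) z * ζ)‖) ∂discArea := by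
        refine norm_integral_le_of_norm_le (hint.const_mul M) ?_
        filter_upwards [hgM, ae_discArea_mem_ball] with ζ hζ hζ1
        rw [norm_mul, norm_mul, RCLike.norm_conj, hnorm, ← mul_assoc M]
        refine mul_le_mul hζ (mul_le_of_le_one_left (norm_nonneg _) (mem_ball_zero_iff.1 hζ1).le)
          (by positivity) ((norm_nonneg _).trans hζ)
    _ = M * ∫ r in Ioo (0 : ℝ) 1, (r / Real.pi) • ∫ θ in Ioo (-Real.pi) Real.pi,
          sqrtTailWeight ω ‖Complex.polarCoord.symm (r, θ)‖ *
          ‖kernelSeriesDeriv ω ((starRingEnd ℂ) z * Complex.polarCoord.symm (r, θ))‖ := by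
        rw [integral_const_mul, integral_discArea_smul hint]
    _ ≤ M * ∫ r in Ioo (0 : ℝ) 1,
          C / (2 * (1 - x)) * (sqrtTailWeight ω r / radialTail ω (x * r)) := by
        refine mul_le_mul_of_nonneg_left ?_ hM
        refine integral_mono_of_nonneg ?_ (hrint.const_mul _) ?_
        · filter_upwards [ae_restrict_mem measurableSet_Ioo] with r hr
          refine smul_nonneg (div_nonneg hr.1.le Real.pi_pos.le) (integral_nonneg fun θ => ?_)
          simp only [Complex.norm_polarCoord_symm, abs_of_pos hr.1]
          exact mul_nonneg (hν.nonneg r ⟨hr.1.le, hr.2⟩) (norm_nonneg _)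
        · filter_upwards [ae_restrict_mem measurableSet_Ioo] with r hr using hstep r hr
    _ ≤ M * (C / (2 * (1 - x)) * (2 / √(radialTail ω x))) := by
        rw [integral_const_mul, ← integral_Ioc_eq_integral_Ioo,
          ← intervalIntegral.integral_of_le zero_le_one]
        have := hω.integral_sqrtTailWeight_div_le ⟨hx0, hz⟩
        gcongr
    _ = _ := by field_simp

end IsRadialWeight

/-! ### Sufficiency: lower doubling integrates the derivative bound. -/

namespace IsRadialWeight

variable {ω ν : ℝ → ℝ}

/-- For a lower doubling weight, a derivative bound integrates to a growth bound. -/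
theorem exists_growth_bound (hω : IsRadialWeight ω) (hL : LowerDoubling ω) {C₀ C₁ : ℝ}
    (hC₀ : 0 ≤ C₀) (hC₁ : 0 ≤ C₁) :
    ∃ A : ℝ, 0 ≤ A ∧ ∀ (G G' : ℂ → ℂ) (M : ℝ), 0 ≤ M →
      (∀ z, ‖z‖ < 1 → HasDerivAt G (G' z) z) → ‖G 0‖ ≤ C₀ * M →
      (∀ z, ‖z‖ < 1 → ‖G' z‖ ≤ C₁ * M / ((1 - ‖z‖) * √(radialTail ω ‖z‖))) →
      ∀ z, ‖z‖ < 1 → ‖G z‖ * √(radialTail ω ‖z‖) ≤ A * M := by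
  obtain ⟨K, c, hK, hc, hev⟩ := hL
  obtain ⟨r₀, hr₀, h⟩ := (mem_nhdsLT_iff_exists_Ioo_subset).1 hev
  have hr₀1 : r₀ < 1 := hr₀
  set a := max r₀ 0 with ha
  have ha0 : 0 ≤ a := le_max_right _ _
  have ha1 : a < 1 := max_lt hr₀1 one_pos
  have hK0 : 0 < K := by linarith
  -- For `|z| > R` the inner radius `1 - K(1-|z|)` exceeds `a`, where lower doubling is available.
  set R := 1 - (1 - a) / K with hR
  have hR1 : 0 < 1 - R := by rw [hR, sub_sub_cancel]; exact div_pos (by linarith) hK0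
  have hsc : 1 < √c := by rw [Real.lt_sqrt zero_le_one]; simpa using hc
  set q := (√c)⁻¹ with hq
  have hq0 : 0 < q := inv_pos.2 (by linarith)
  have hq1 : q < 1 := inv_lt_one_of_one_lt₀ hsc
  -- The first entry handles `|z| ≤ R`; the second is exactly what makes `qA + C₁(K-1) ≤ A`, so the
  -- bound survives each outward step.
  set A := max (C₀ * √(radialTail ω 0) + C₁ / (1 - R)) (C₁ * (K - 1) / (1 - q)) with hA
  have hA0 : 0 ≤ A := le_trans (by positivity) (le_max_left _ _)
  refine ⟨A, hA0, fun G G' M hM hG hG0 hG' => ?_⟩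
  -- Mean value inequality between `sz` and `z`: `(1-ρ)√ω̂(ρ)` decreases, so the derivative bound at
  -- radius `|z|` holds on the whole closed disc of that radius.
  have hmv : ∀ z : ℂ, ‖z‖ < 1 → ∀ s ∈ Icc (0 : ℝ) 1,
      ‖G z‖ * √(radialTail ω ‖z‖) ≤ ‖G ((s : ℂ) * z)‖ * √(radialTail ω ‖z‖) +
        C₁ * M / (1 - ‖z‖) * ((1 - s) * ‖z‖) := by
    intro z hz s hs
    have hzT := Real.sqrt_pos.2 (hω.tail_pos _ ⟨norm_nonneg z, hz⟩)
    have hz1 : 0 < 1 - ‖z‖ := sub_pos.2 hz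
    have hball : ∀ w ∈ Metric.closedBall (0 : ℂ) ‖z‖, ‖w‖ ≤ ‖z‖ := fun w hw => by simpa using hw
    have hsz : (s : ℂ) * z ∈ Metric.closedBall (0 : ℂ) ‖z‖ := by
      rw [mem_closedBall_zero_iff, norm_mul, Complex.norm_of_nonneg hs.1]
      exact mul_le_of_le_one_left (norm_nonneg _) hs.2
    have hb : ∀ w ∈ Metric.closedBall (0 : ℂ) ‖z‖,
        ‖G' w‖ ≤ C₁ * M / ((1 - ‖z‖) * √(radialTail ω ‖z‖)) := by
      intro w hw
      have hw' := hball w hw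
      refine (hG' w (hw'.trans_lt hz)).trans ?_
      refine div_le_div_of_nonneg_left (by positivity) (by positivity) ?_
      refine mul_le_mul (by linarith) (Real.sqrt_le_sqrt ?_) (Real.sqrt_nonneg _) (by linarith)
      exact hω.tail_antitone ⟨norm_nonneg w, (hw'.trans_lt hz).le⟩ ⟨norm_nonneg z, hz.le⟩ hw'
    have hmvt := (convex_closedBall (0 : ℂ) ‖z‖).norm_image_sub_le_of_norm_hasDerivWithin_le
      (fun w hw => (hG w ((hball w hw).trans_lt hz)).hasDerivWithinAt) hb hsz
      (show z ∈ Metric.closedBall (0 : ℂ) ‖z‖ by simp)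
    have hdist : ‖z - (s : ℂ) * z‖ = (1 - s) * ‖z‖ := by
      rw [show z - (s : ℂ) * z = ((1 - s : ℝ) : ℂ) * z by push_cast; ring, norm_mul,
        Complex.norm_of_nonneg (sub_nonneg.2 hs.2)]
    rw [hdist] at hmvt
    have h1 : ‖G z‖ ≤ ‖G ((s : ℂ) * z)‖ +
        C₁ * M / ((1 - ‖z‖) * √(radialTail ω ‖z‖)) * ((1 - s) * ‖z‖) := by
      have := norm_le_norm_add_norm_sub' (G z) (G ((s : ℂ) * z))
      linarith
    have h2 := mul_le_mul_of_nonneg_right h1 hzT.le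
    refine h2.trans (le_of_eq ?_)
    field_simp
  have hinner : ∀ z : ℂ, ‖z‖ < 1 → ‖z‖ ≤ R → ‖G z‖ * √(radialTail ω ‖z‖) ≤ A * M := by
    intro z hz hzR
    have h1 := hmv z hz 0 (by simp)
    rw [Complex.ofReal_zero, zero_mul, sub_zero, one_mul] at h1
    have hT0 : √(radialTail ω ‖z‖) ≤ √(radialTail ω 0) := Real.sqrt_le_sqrt
      (hω.tail_antitone (by simp) ⟨norm_nonneg z, hz.le⟩ (norm_nonneg z))
    have h2 : ‖G 0‖ * √(radialTail ω ‖z‖) ≤ C₀ * M * √(radialTail ω 0) :=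
      mul_le_mul hG0 hT0 (Real.sqrt_nonneg _) (by positivity)
    have h3 : C₁ * M / (1 - ‖z‖) * ‖z‖ ≤ C₁ * M / (1 - R) * 1 :=
      mul_le_mul (div_le_div_of_nonneg_left (by positivity) hR1 (by linarith)) hz.le
        (norm_nonneg z) (by positivity)
    calc _ ≤ C₀ * M * √(radialTail ω 0) + C₁ * M / (1 - R) * 1 := by linarith
      _ = (C₀ * √(radialTail ω 0) + C₁ / (1 - R)) * M := by ring
      _ ≤ A * M := mul_le_mul_of_nonneg_right (le_max_left _ _) hM
  -- Induction on the number of `K`-steps from the disc of radius `R`. Passing from radius `y`, `1-y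
  -- = K(1-x)`, to `x` costs at most `C₁(K-1)M`, while lower doubling shrinks the old bound by `q =
  -- 1/√c < 1`.
  have hind : ∀ n : ℕ, ∀ z : ℂ, ‖z‖ < 1 → (1 - R) / K ^ n ≤ 1 - ‖z‖ →
      ‖G z‖ * √(radialTail ω ‖z‖) ≤ A * M := by
    intro n
    induction n with
    | zero =>
      intro z hz hzn
      rw [pow_zero, div_one] at hzn
      exact hinner z hz (by linarith)
    | succ n ih =>
      intro z hz hzn
      by_cases hzR : ‖z‖ ≤ R
      · exact hinner z hz hzR
      push Not at hzR
      set x := ‖z‖ with hx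
      set y := 1 - K * (1 - x) with hy
      have hx1 : 0 < 1 - x := sub_pos.2 hz
      have hya : a < y := by
        have : 1 - x < (1 - a) / K := by rw [hR] at hzR; linarith
        rw [lt_div_iff₀ hK0] at this
        rw [hy]; linarith
      have hyx : y < x := by rw [hy]; nlinarith
      have hy0 : 0 ≤ y := ha0.trans hya.le
      have hx0 : 0 < x := hy0.trans_lt hyx
      have hw : ‖((y / x : ℝ) : ℂ) * z‖ = y := by
        rw [norm_mul, Complex.norm_of_nonneg (by positivity), ← hx, div_mul_cancel₀ _ hx0.ne']
      have h1 := hmv z hz (y / x) ⟨by positivity, (div_le_one hx0).2 hyx.le⟩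
      have h2 := ih (((y / x : ℝ) : ℂ) * z) (by rw [hw]; linarith) (by
        have hy1 : 1 - y = K * (1 - x) := by rw [hy]; ring
        rw [hw, hy1]
        rw [pow_succ, ← div_div, div_le_iff₀ hK0] at hzn
        linarith)
      rw [hw] at h2
      rw [← hx] at h1
      have hd : c * radialTail ω x ≤ radialTail ω y := by
        have := h ⟨(le_max_left _ _).trans_lt hya, hyx.trans hz⟩
        simp only [mem_ofPred_eq] at this
        rwa [show 1 - (1 - y) / K = x by rw [hy]; field_simp; ring] at this
      have hsq : √c * √(radialTail ω x) ≤ √(radialTail ω y) := by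
        rw [← Real.sqrt_mul (by linarith)]; exact Real.sqrt_le_sqrt hd
      have h3 : ‖G (((y / x : ℝ) : ℂ) * z)‖ * √(radialTail ω x) ≤ A * M * q := by
        have h4 := mul_le_mul_of_nonneg_left hsq (norm_nonneg (G (((y / x : ℝ) : ℂ) * z)))
        rw [hq, ← div_eq_mul_inv, le_div_iff₀ (by linarith)]
        calc _ = ‖G (((y / x : ℝ) : ℂ) * z)‖ * (√c * √(radialTail ω x)) := by ring
          _ ≤ _ := h4.trans h2
      have h5 : C₁ * M / (1 - x) * ((1 - y / x) * x) = C₁ * (K - 1) * M := by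
        rw [sub_mul, one_mul, div_mul_cancel₀ _ hx0.ne', hy]
        field_simp
        ring
      rw [h5] at h1
      have h6 : C₁ * (K - 1) ≤ A * (1 - q) := by
        rw [← div_le_iff₀ (sub_pos.2 hq1)]; exact le_max_right _ _
      have h7 := mul_le_mul_of_nonneg_right h6 hM
      linarith
  intro z hz
  obtain ⟨n, hn⟩ := exists_pow_lt_of_lt_one (div_pos (sub_pos.2 hz) hR1)
    (inv_lt_one_of_one_lt₀ hK)
  refine hind n z hz ?_
  rw [inv_pow, lt_div_iff₀ hR1] at hn
  rw [div_eq_inv_mul]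
  exact hn.le

/-- The projection is bounded on the growth space of the weight `√ω̂`. -/
theorem bergmanProjectionBounded_sqrtTailWeight (hω : IsRadialWeight ω) (hD : UpperDoubling ω)
    (hL : LowerDoubling ω) : BergmanProjectionBounded ω (radialTail (sqrtTailWeight ω)) := by
  have hν := hω.isRadialWeight_sqrtTailWeight
  obtain ⟨C₁, hC₁, hder⟩ := hω.exists_norm_deriv_le hD
  set I := ∫ ζ : ℂ, sqrtTailWeight ω ‖ζ‖ ∂discArea with hI
  have hI0 : 0 ≤ I := integral_nonneg_of_ae (ae_discArea_mem_ball.mono fun ζ hζ =>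
    hν.nonneg _ ⟨norm_nonneg ζ, mem_ball_zero_iff.1 hζ⟩)
  have ha0 := (hω.kernelCoeff_pos 0).le
  obtain ⟨A, hA0, hA⟩ := hω.exists_growth_bound hL (C₀ := 2 * (I * kernelCoeff ω 0))
    (C₁ := C₁ * 2) (by positivity) (by positivity)
  refine ⟨A.toNNReal, fun f hf => ?_⟩
  set M := (growthNorm (radialTail (sqrtTailWeight ω)) f).toReal with hM
  have hM0 : 0 ≤ M := ENNReal.toReal_nonneg
  -- `|f| ω ≤ M ω/√ω̂`, which is `2M` times the new weight; its integrability gives absolute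
  -- convergence.
  have hgM : ∀ᵐ ζ ∂discArea, ‖f ζ * (ω ‖ζ‖ : ℂ)‖ ≤ 2 * M * sqrtTailWeight ω ‖ζ‖ := by
    filter_upwards [ae_le_growthNorm hf.2, ae_discArea_mem_ball] with ζ h1 hζ
    have hζ' := mem_ball_zero_iff.1 hζ
    rw [hω.tail_sqrtTailWeight ⟨norm_nonneg ζ, hζ'.le⟩] at h1
    have hs := Real.sqrt_pos.2 (hω.tail_pos_of_mem_ball hζ)
    have h0 := hω.nonneg _ ⟨norm_nonneg ζ, hζ'⟩
    rw [norm_mul, Complex.norm_of_nonneg h0, sqrtTailWeight]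
    have h2 : ‖f ζ‖ ≤ M / √(radialTail ω ‖ζ‖) := by rwa [le_div_iff₀ hs]
    refine (mul_le_mul_of_nonneg_right h2 h0).trans (le_of_eq ?_)
    field_simp
  have hg : Integrable (fun ζ => f ζ * (ω ‖ζ‖ : ℂ)) discArea :=
    Integrable.mono' (hν.integrable_weight_real.const_mul (2 * M))
      (hf.1.mul hω.integrable_weight.1) hgM
  set G : ℂ → ℂ := fun z => ∫ ζ, f ζ * (ω ‖ζ‖ : ℂ) * kernelSeries ω (z * (starRingEnd ℂ) ζ) ∂discArea
    with hG
  have hPG : ∀ z ∈ Metric.ball (0 : ℂ) 1, bergmanProjection ω f z = G z := fun z hz =>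
    hω.bergmanProjection_eq f (mem_ball_zero_iff.1 hz)
  have hderiv := fun z hz => hω.hasDerivAt_integral_kernelSeries hg (z := z) hz
  have hG0 : ‖G 0‖ ≤ 2 * (I * kernelCoeff ω 0) * M := by
    have hK : kernelSeries ω 0 = kernelCoeff ω 0 := by
      unfold kernelSeries
      rw [tsum_eq_single 0 (fun n hn => by simp [hn])]
      simp
    simp only [hG, zero_mul, hK]
    rw [integral_mul_const, norm_mul, Complex.norm_of_nonneg ha0]
    have := norm_integral_le_of_norm_le (hν.integrable_weight_real.const_mul (2 * M)) hgM
    rw [integral_const_mul] at this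
    calc _ ≤ 2 * M * I * kernelCoeff ω 0 := mul_le_mul_of_nonneg_right this ha0
      _ = _ := by ring
  have hbound : ∀ z, ‖z‖ < 1 → ‖G z‖ * √(radialTail ω ‖z‖) ≤ A * M :=
    hA G _ M hM0 hderiv hG0 fun z hz =>
      (hder _ (2 * M) (by positivity) hg hgM z hz).trans (le_of_eq (by ring))
  have hbound' : ∀ z ∈ Metric.ball (0 : ℂ) 1,
      ‖bergmanProjection ω f z‖ * radialTail (sqrtTailWeight ω) ‖z‖ ≤ A * M := by
    intro z hz
    have hz' := mem_ball_zero_iff.1 hz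
    rw [hPG z hz, hω.tail_sqrtTailWeight ⟨norm_nonneg z, hz'.le⟩]
    exact hbound z hz'
  have hdiff : DifferentiableOn ℂ (bergmanProjection ω f) (Metric.ball 0 1) := by
    have : DifferentiableOn ℂ G (Metric.ball 0 1) := fun z hz =>
      (hderiv z (mem_ball_zero_iff.1 hz)).differentiableAt.differentiableWithinAt
    exact this.congr hPG
  refine ⟨fun z hz => ?_, ⟨memGrowth_of_le
    (continuousOn_aestronglyMeasurable_discArea hdiff.continuousOn) hbound', hdiff⟩, ?_⟩
  · have hz' := mem_ball_zero_iff.1 hz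
    exact (integrable_mul_bounded hg
      (continuousOn_comp_mul_conj hω.differentiableOn_kernelSeries.continuousOn hz')
      fun ζ hζ => hω.norm_kernelSeries_le hz' (norm_mul_conj_le hζ)).congr
      (hω.bergmanIntegrand_eq f hz').symm
  · have hfin : ((A.toNNReal : NNReal) : ENNReal) * growthNorm (radialTail (sqrtTailWeight ω)) f =
        ENNReal.ofReal (A * M) := by
      rw [ENNReal.ofReal_mul hA0, hM, ENNReal.ofReal_toReal hf.2.ne]; rfl
    rw [hfin]
    refine essSup_le_of_ae_le _ ?_
    filter_upwards [ae_discArea_mem_ball] with z hz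
    exact ENNReal.ofReal_le_ofReal (hbound' z hz)

end IsRadialWeight

theorem mainTheorem8 (ω : ℝ → ℝ) (hω : IsRadialWeight ω) (hωD : UpperDoubling ω) :
    ((∃ ν : ℝ → ℝ, IsRadialWeight ν ∧ BergmanProjectionBounded ω (radialTail ν)) ↔
      LowerDoubling ω) ∧
    (¬ LowerDoubling ω →
      ∀ ν : ℝ → ℝ, IsRadialWeight ν → ¬ BergmanProjectionBounded ω (radialTail ν)) :=
  ⟨⟨fun ⟨_, hν, hb⟩ => hω.lowerDoubling_of_bounded hωD hν hb, fun hL =>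
    ⟨sqrtTailWeight ω, hω.isRadialWeight_sqrtTailWeight,
      hω.bergmanProjectionBounded_sqrtTailWeight hωD hL⟩⟩,
    fun hL _ hν hb => hL (hω.lowerDoubling_of_bounded hωD hν hb)⟩
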